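/- \textbf{Arithmetic model.} Programs act on real scalars by loading constants, by $+,-,\times,/$ and $\sqrt{\cdot}$, and by comparisons. In floating-point arithmetic with machine epsilon $\varepsilon$, each arithmetic operation and each square root returns some number with relative error at most $\varepsilon$ (i.e. $\mathrm{fl}(x\ \mathrm{op}\ y)=(x\ \mathrm{op}\ y)(1+\delta)$ with $|\delta|\le\varepsilon$, where $\delta$ may differ from operation to operation); comparisons and constants are exact. Arithmetic operations, square roots and comparisons count as one operation each. Statements about executions hold for all possible roundings. $\|\cdot\|$ is the spectral norm. \textbf{Matrix multiplication.} Let $MM$ be a routine that consists, for every $k\ge1$, of a program taking two $k\times k$ matrices to a $k\times k$ matrix. Products of $p\times q$ by $q\times r$ matrices are computed by cutting both factors into $k\times k$ blocks, $k=\min(p,q,r)$ (zero-padded at the border), multiplying the blocks by $MM$ and summing. \textbf{Algorithm.} For an $n\times m$ matrix $A$ with $n\ge m$, $[R,W,Y]=QRR(A)$ is computed recursively, with $l=\lfloor m/2\rfloor$: If $m=1$: compute $\sigma\approx\|A\|$ (square root of the sum of squares). If $\sigma>0$, put $R=\sigma$ if $A_1<0$ and $R=-\sigma$ otherwise, $v=A-R\,e_1$,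 and return $R$, $W=v/\|v\|_2$, $Y=2W^T$ (Householder transformation $I-WY$); if $\sigma=0$, return $R=0$, $W=e_1$, $Y=2e_1^T$. If $m\ge2$: $[R_L,W_L,Y_L]=QRR(A(:,1:l))$; $A_R=A(:,l+1:m)-W_L(Y_L\,A(:,l+1:m))$; $[R_R,W_R,Y_R]=QRR(A_R(l+1:n,:))$; $X=W_L-[0;\,W_R(Y_R\,W_L(l+1:n,:))]$ (the first $l$ rows of $W_L$ being copied); return $$R=\begin{bmatrix}R_L&A_R(1:l,:)\\0&R_R\end{bmatrix},\qquad W=\begin{bmatrix}X,&\begin{bmatrix}0\\W_R\end{bmatrix}\end{bmatrix},\qquad Y=\begin{bmatrix}Y_L\\ [\,0,\ Y_R\,]\end{bmatrix}.$$ (For $m=0$ the outputs are empty matrices.) \textbf{Theorem.} Let $MM$ be such a routine. (1) Let $\gamma>2$ and suppose that there is $C$ such that, for all $k\ge1$, $0\le\varepsilon<1$, every execution of $MM$ on two $k\times k$ matrices takes at most $Ck^\gamma$ operations. Then there is $C'$ such that, for all $n\ge m$, $0\le\varepsilon<1$ and every $n\times m$ real matrix $A$, every execution of $QRR(A)$ takes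 at most $C'\,n\,m^{\gamma-1}$ operations. (2) Suppose that $MM$ satisfies the normwise error bound $$\|P_{comp}-AB\|\le\mu(k)\,\varepsilon\,\|A\|\,\|B\|+O(\varepsilon^2)\,\|A\|\,\|B\|,\qquad \mu(k)=O(k^{d})\text{ for some constant } d,$$ for the computed product $P_{comp}$ of any two $k\times k$ matrices $A,B$; here $O(\varepsilon^2)$ is as $\varepsilon\to0$ for fixed $k$, uniformly in $A$, $B$ and the roundings. Then there are constants $K,c$ such that for all $n\ge m$ there is $\varepsilon_0>0$ such that, for all $0<\varepsilon\le\varepsilon_0$, every $n\times m$ real matrix $A$ and every possible computed output $[R,W,Y]$ of $QRR(A)$: $R$ is upper triangular, and there are matrices $\delta Q^T$ ($n\times n$) and $\delta A$ ($n\times m$) such that $Q^T=I-WY+\delta Q^T$ is exactly orthogonal, $$(I-WY+\delta Q^T)(A+\delta A)=\begin{bmatrix}R\\0\end{bmatrix},\qquad \|\delta Q^T\|\le K n^{c}\,\varepsilon,\qquad \|\delta A\|\le K n^{c}\,\varepsilon\,\|A\|.$$ -/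

import Mathlib

open scoped Matrix.Norms.L2Operator

/-! ### Arithmetic programs and their floating-point executions -/

/-- The four binary arithmetic operations. -/
inductive ArithOp
  | add | sub | mul | div

/-- The exact value of a binary arithmetic operation. -/
noncomputable def ArithOp.eval : ArithOp → ℝ → ℝ → ℝ
  | .add, x, y => x + y
  | .sub, x, y => x - y
  | .mul, x, y => x * y
  | .div, x, y => x / y

/-- Arithmetic programs that return a value of type `α`. The scalars that a program handles belong to
an abstract type `V`: a program which is defined for an arbitrary `V` can only create scalars by
loading constants or by arithmetic operations and square roots, and can only inspect them by
comparisons. -/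
inductive Prog (V : Type) (α : Type) : Type
  | ret (a : α)
  | const (c : ℝ) (k : V → Prog V α)
  | arith (o : ArithOp) (x y : V) (k : V → Prog V α)
  | sqrt (x : V) (k : V → Prog V α)
  | less (x y : V) (k : Bool → Prog V α)

namespace Prog

variable {V α β : Type}

/-- Sequential composition of programs. -/
def bind : Prog V α → (α → Prog V β) → Prog V β
  | ret a, f => f a
  | const c k, f => const c fun z => (k z).bind f
  | arith o x y k, f => arith o x y fun z => (k z).bind f
  | sqrt x k, f => sqrt x fun z => (k z).bind f
  | less x y k, f => less x y fun b => (k b).bind f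

instance : Monad (Prog V) where
  pure := ret
  bind := bind

/-- `p.Exec ε a t`: an execution of `p` in floating-point arithmetic with machine epsilon `ε` can
return `a` after `t` operations. Every arithmetic operation and every square root returns some number
whose relative error is at most `ε`, that is, `fl (x op y) = (x op y) * (1 + δ)` with `|δ| ≤ ε`, where
`δ` may be different each time; comparisons and constants are exact. Arithmetic operations, square
roots and comparisons count as one operation each. -/
noncomputable def Exec (ε : ℝ) : Prog ℝ α → α → ℕ → Prop
  | ret a, b, t => b = a ∧ t = 0
  | const c k, b, t => (k c).Exec ε b t
  | arith o x y k, b, t =>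
      ∃ z s, |z - o.eval x y| ≤ ε * |o.eval x y| ∧ (k z).Exec ε b s ∧ t = s + 1
  | sqrt x k, b, t =>
      ∃ z s, |z - Real.sqrt x| ≤ ε * |Real.sqrt x| ∧ (k z).Exec ε b s ∧ t = s + 1
  | less x y k, b, t =>
      open Classical in ∃ s, (k (decide (x < y))).Exec ε b s ∧ t = s + 1

/-- Load a constant. -/
def literal (c : ℝ) : Prog V V := const c ret

/-- Floating-point addition. -/
def fadd (x y : V) : Prog V V := arith .add x y ret

/-- Floating-point subtraction. -/
def fsub (x y : V) : Prog V V := arith .sub x y ret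

/-- Floating-point multiplication. -/
def fmul (x y : V) : Prog V V := arith .mul x y ret

/-- Floating-point division. -/
def fdiv (x y : V) : Prog V V := arith .div x y ret

/-- Floating-point square root. -/
def fsqrt (x : V) : Prog V V := sqrt x ret

/-- Comparison of two scalars. -/
def isLess (x y : V) : Prog V Bool := less x y ret

/-- Run the programs `f 0, …, f (n - 1)` one after the other and collect their results. -/
def tabulate : {n : ℕ} → (Fin n → Prog V α) → Prog V (Fin n → α)
  | 0, _ => pure Fin.elim0
  | _ + 1, f => do
      let a ← f 0
      let g ← tabulate fun i => f i.succ
      pure (Fin.cons a g)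

end Prog

/-! ### Submatrices and block matrices -/

section Blocks

variable {V : Type} {n m a : ℕ}

/-- The index `a + j`, for `j < n - a`. -/
def upperIdx (h : a ≤ n) (j : Fin (n - a)) : Fin n := ⟨a + j, by omega⟩

/-- The first `a` columns, `A(:, 1:a)`. -/
def leftCols (h : a ≤ m) (A : Matrix (Fin n) (Fin m) V) : Matrix (Fin n) (Fin a) V :=
  A.submatrix id (Fin.castLE h)

/-- The columns after the first `a` ones, `A(:, a+1:m)`. -/
def rightCols (h : a ≤ m) (A : Matrix (Fin n) (Fin m) V) : Matrix (Fin n) (Fin (m - a)) V :=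
  A.submatrix id (upperIdx h)

/-- The first `a` rows, `A(1:a, :)`. -/
def topRows (h : a ≤ n) (A : Matrix (Fin n) (Fin m) V) : Matrix (Fin a) (Fin m) V :=
  A.submatrix (Fin.castLE h) id

/-- The rows after the first `a` ones, `A(a+1:n, :)`. -/
def bottomRows (h : a ≤ n) (A : Matrix (Fin n) (Fin m) V) : Matrix (Fin (n - a)) (Fin m) V :=
  A.submatrix (upperIdx h) id

/-- Concatenation of a family of length `a` and a family of length `n - a`. -/
def glue {α : Type} (f : Fin a → α) (g : Fin (n - a) → α) : Fin n → α :=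
  fun i => if hi : i.val < a then f ⟨i, hi⟩ else g ⟨i - a, by omega⟩

/-- The block matrix `[A; B]`. -/
def vcat (A : Matrix (Fin a) (Fin m) V) (B : Matrix (Fin (n - a)) (Fin m) V) :
    Matrix (Fin n) (Fin m) V :=
  Matrix.of fun i j => glue (fun i' => A i' j) (fun i' => B i' j) i

/-- The block matrix `[A, B]`. -/
def hcat (A : Matrix (Fin n) (Fin a) V) (B : Matrix (Fin n) (Fin (m - a)) V) :
    Matrix (Fin n) (Fin m) V :=
  Matrix.of fun i j => glue (A i) (B i) j

/-- The matrix all of whose entries are the scalar `z`. -/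
def constMat (n m : ℕ) (z : V) : Matrix (Fin n) (Fin m) V := Matrix.of fun _ _ => z

end Blocks

/-! ### Matrix operations -/

/-- Entrywise addition of matrices. -/
def matAdd {V : Type} {n m : ℕ} (A B : Matrix (Fin n) (Fin m) V) :
    Prog V (Matrix (Fin n) (Fin m) V) :=
  Prog.tabulate fun i => Prog.tabulate fun j => Prog.fadd (A i j) (B i j)

/-- Entrywise subtraction of matrices. -/
def matSub {V : Type} {n m : ℕ} (A B : Matrix (Fin n) (Fin m) V) :
    Prog V (Matrix (Fin n) (Fin m) V) :=
  Prog.tabulate fun i => Prog.tabulate fun j => Prog.fsub (A i j) (B i j)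

/-- A routine for the multiplication of square matrices: for every `k`, a program that takes two
`k`-by-`k` matrices and returns a `k`-by-`k` matrix. -/
def MatMul : Type 1 :=
  ∀ (V : Type) (k : ℕ), Matrix (Fin k) (Fin k) V → Matrix (Fin k) (Fin k) V →
    Prog V (Matrix (Fin k) (Fin k) V)

/-- The routine multiplies `k`-by-`k` matrices in `O(k ^ γ)` operations. -/
def MatMul.HasCost (mm : MatMul) (γ : ℝ) : Prop :=
  ∃ C : ℝ, ∀ k : ℕ, 1 ≤ k → ∀ ε : ℝ, 0 ≤ ε → ε < 1 →
    ∀ (A B P : Matrix (Fin k) (Fin k) ℝ) (t : ℕ),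
      (mm ℝ k A B).Exec ε P t → (t : ℝ) ≤ C * (k : ℝ) ^ γ

/-- The normwise error bound `‖P - A * B‖ ≤ μ(k) ε ‖A‖ ‖B‖ + O(ε ^ 2)` for the computed product `P` of
two `k`-by-`k` matrices, in the spectral norm. Here `μ(k) = O(k ^ c)`, and the term `O(ε ^ 2)`, which
refers to `ε → 0` for fixed `k`, is relative to `‖A‖ ‖B‖`. -/
def MatMul.IsStable (mm : MatMul) : Prop :=
  ∃ (M : ℝ) (c : ℕ), ∀ k : ℕ, 1 ≤ k → ∃ (L : ℝ) (ε₁ : ℝ), 0 < ε₁ ∧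
    ∀ ε : ℝ, 0 < ε → ε ≤ ε₁ → ∀ (A B P : Matrix (Fin k) (Fin k) ℝ) (t : ℕ),
      (mm ℝ k A B).Exec ε P t →
        ‖P - A * B‖ ≤ M * (k : ℝ) ^ c * ε * ‖A‖ * ‖B‖ + L * ε ^ 2 * ‖A‖ * ‖B‖

/-- The `(I, J)` block of size `k`-by-`k` of a matrix, filled up with the scalar `zero` where it
sticks out of the matrix. -/
def paddedBlock {V : Type} {p q : ℕ} (k : ℕ) (zero : V) (A : Matrix (Fin p) (Fin q) V) (I J : ℕ) :
    Matrix (Fin k) (Fin k) V :=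
  Matrix.of fun i j =>
    if h : I * k + i < p ∧ J * k + j < q then A ⟨I * k + i, h.1⟩ ⟨J * k + j, h.2⟩ else zero

theorem div_lt_ceilDiv {k p i : ℕ} (hk : 0 < k) (hi : i < p) : i / k < (p + k - 1) / k := by
  rw [Nat.div_lt_iff_lt_mul hk]
  have h := Nat.div_add_mod (p + k - 1) k
  have h' := Nat.mod_lt (p + k - 1) hk
  rw [Nat.mul_comm] at h
  omega

/-- Multiplication of a `p`-by-`q` and a `q`-by-`r` matrix. With `k = min p q r`, both matrices are cut
into `k`-by-`k` blocks, the blocks are multiplied by the routine `mm`, and the products are summed. -/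
def rectMul (mm : MatMul) {V : Type} {p q r : ℕ} (A : Matrix (Fin p) (Fin q) V)
    (B : Matrix (Fin q) (Fin r) V) : Prog V (Matrix (Fin p) (Fin r) V) := do
  let zero ← Prog.literal 0
  if hk : 0 < min p (min q r) then
    let k := min p (min q r)
    let S : Fin ((p + k - 1) / k) → Fin ((r + k - 1) / k) → Matrix (Fin k) (Fin k) V ←
      Prog.tabulate fun I => Prog.tabulate fun J =>
        (List.range ((q + k - 1) / k)).foldlM (init := constMat k k zero) fun acc K => do
          let P ← mm V k (paddedBlock k zero A I K) (paddedBlock k zero B K J)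
          matAdd acc P
    pure (Matrix.of fun i j =>
      S ⟨i / k, div_lt_ceilDiv hk i.isLt⟩ ⟨j / k, div_lt_ceilDiv hk j.isLt⟩
        ⟨i % k, Nat.mod_lt _ hk⟩ ⟨j % k, Nat.mod_lt _ hk⟩)
  else
    pure (constMat p r zero)

/-! ### Recursive QR decomposition -/

/-- The Euclidean length of a vector. -/
def vecLength {V : Type} {n : ℕ} (x : Fin n → V) : Prog V V := do
  let zero ← Prog.literal 0
  let s ← (List.finRange n).foldlM (init := zero) fun acc i => do
    let p ← Prog.fmul (x i) (x i)
    Prog.fadd acc p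
  Prog.fsqrt s

/-- The Householder transformation `I - w y` that maps the vector `x` to `ρ e₁`, with `ρ = ± ‖x‖`,
`‖w‖ = 1`, `y = 2 wᵀ`. The vector `w` is `v / ‖v‖` with `v = x + sign(x₁) ‖x‖ e₁`, and `w = e₁` if
`x = 0`. The program returns `(ρ, w, y)`. -/
def householder {V : Type} {n : ℕ} (hn : 0 < n) (x : Fin n → V) :
    Prog V (V × (Fin n → V) × (Fin n → V)) := do
  let zero ← Prog.literal 0
  let one ← Prog.literal 1
  let two ← Prog.literal 2
  let first : Fin n := ⟨0, hn⟩
  let σ ← vecLength x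
  let nonzero ← Prog.isLess zero σ
  if nonzero then
    let negative ← Prog.isLess (x first) zero
    let ρ ← if negative then pure σ else Prog.fsub zero σ
    let v₁ ← Prog.fsub (x first) ρ
    let v : Fin n → V := fun i => if i = first then v₁ else x i
    let τ ← vecLength v
    let w ← Prog.tabulate fun i => Prog.fdiv (v i) τ
    let y ← Prog.tabulate fun i => Prog.fmul two (w i)
    pure (ρ, w, y)
  else
    pure (zero, (fun i => if i = first then one else zero),
      (fun i => if i = first then two else zero))

/-- The recursive QR decomposition of an `n`-by-`m` matrix `A` with `m ≤ n`, based on the routine `mm`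
for matrix multiplication. It returns `(R, W, Y)` where `R` is `m`-by-`m`, `W` is `n`-by-`m` and
`Y` is `m`-by-`n`; in exact arithmetic, `I - W Y` is orthogonal and `(I - W Y) A = [R; 0]`. -/
def qrr (mm : MatMul) {V : Type} : (n m : ℕ) → m ≤ n → Matrix (Fin n) (Fin m) V →
    Prog V (Matrix (Fin m) (Fin m) V × Matrix (Fin n) (Fin m) V × Matrix (Fin m) (Fin n) V)
  | _, 0, _, _ =>
      pure (Matrix.of fun i _ => i.elim0, Matrix.of fun _ j => j.elim0, Matrix.of fun i _ => i.elim0)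
  | _, 1, h, A => do
      let (ρ, w, y) ← householder h fun i => A i 0
      pure (Matrix.of fun _ _ => ρ, Matrix.of fun i _ => w i, Matrix.of fun _ j => y j)
  | n, m + 2, h, A => do
      let zero ← Prog.literal 0
      have hl : (m + 2) / 2 ≤ m + 2 := Nat.div_le_self _ _
      have hn : (m + 2) / 2 ≤ n := hl.trans h
      -- factor the left half
      let (RL, WL, YL) ← qrr mm n ((m + 2) / 2) hn (leftCols hl A)
      -- update the right half
      let YA ← rectMul mm YL (rightCols hl A)
      let WYA ← rectMul mm WL YA
      let AR ← matSub (rightCols hl A) WYA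
      -- factor the lower part of the right half
      let (RR, WR, YR) ← qrr mm (n - (m + 2) / 2) (m + 2 - (m + 2) / 2) (by omega) (bottomRows hn AR)
      -- multiply the two orthogonal factors
      let YW ← rectMul mm YR (bottomRows hn WL)
      let WYW ← rectMul mm WR YW
      let XB ← matSub (bottomRows hn WL) WYW
      let X : Matrix (Fin n) (Fin ((m + 2) / 2)) V := vcat (topRows hn WL) XB
      pure (vcat (hcat RL (topRows hn AR)) (hcat (constMat _ _ zero) RR),
        hcat X (vcat (constMat _ _ zero) WR),
        vcat YL (hcat (constMat _ _ zero) YR))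
  termination_by _ m => m
  decreasing_by all_goals omega

/-!
The matrices `W` and `Y` are allowed to drift from exact Householder data; what is tracked is the
distance from `I - W Y` to *some* orthogonal `Q`, and from `Q A` to `[R; 0]`. For a single column
the computed vectors are `O(ε)`-close to those of an exact reflection. In the recursion, gluing the
transformations of the two halves adds their errors, up to one further error of the matrix products,
which is under control because `‖W‖` and `‖Y‖` grow only linearly in the number of columns. So the
total error is proportional to the `2 m - 1` nodes of the recursion tree, and `Qᵀ` moves it from
`Q A` back to `A`.

For the operation count, all products at one node cost `O(n m ^ (γ - 1))`: a `p`-by-`q`-by-`r`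
product with smallest dimension `k` takes `O(p q r k ^ (γ - 3))` operations. Since `γ - 1 > 1`,
splitting `m` shrinks the sum of the `(γ - 1)`-st powers by a constant factor, and the costs of
the levels form a geometric series.
-/

/-! ### Executions of composite programs -/

namespace Prog

variable {α β : Type} {ε : ℝ}

theorem exec_pure {a b : α} {t : ℕ} :
    (pure a : Prog ℝ α).Exec ε b t ↔ b = a ∧ t = 0 := Iff.rfl

theorem exec_bind {p : Prog ℝ α} {f : α → Prog ℝ β} {b : β} {t : ℕ} :
    (p >>= f).Exec ε b t ↔ ∃ a s u, p.Exec ε a s ∧ (f a).Exec ε b u ∧ t = s + u := by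
  change (p.bind f).Exec ε b t ↔ _
  induction p generalizing t with
  | ret a => simp only [bind, Exec]; grind
  | const c k ih => simp only [bind, Exec, ih]
  | arith o x y k ih => simp only [bind, Exec, ih]; grind
  | sqrt x k ih => simp only [bind, Exec, ih]; grind
  | less x y k ih => simp only [bind, Exec, ih]; grind

theorem exec_literal {c z : ℝ} {t : ℕ} :
    (literal c : Prog ℝ ℝ).Exec ε z t ↔ z = c ∧ t = 0 := Iff.rfl

theorem exec_fadd {x y z : ℝ} {t : ℕ} :
    (fadd x y).Exec ε z t ↔ |z - (x + y)| ≤ ε * |x + y| ∧ t = 1 := by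
  simp only [fadd, Exec, ArithOp.eval]; grind

theorem exec_fsub {x y z : ℝ} {t : ℕ} :
    (fsub x y).Exec ε z t ↔ |z - (x - y)| ≤ ε * |x - y| ∧ t = 1 := by
  simp only [fsub, Exec, ArithOp.eval]; grind

theorem exec_fmul {x y z : ℝ} {t : ℕ} :
    (fmul x y).Exec ε z t ↔ |z - x * y| ≤ ε * |x * y| ∧ t = 1 := by
  simp only [fmul, Exec, ArithOp.eval]; grind

theorem exec_fdiv {x y z : ℝ} {t : ℕ} :
    (fdiv x y).Exec ε z t ↔ |z - x / y| ≤ ε * |x / y| ∧ t = 1 := by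
  simp only [fdiv, Exec, ArithOp.eval]; grind

theorem exec_fsqrt {x z : ℝ} {t : ℕ} :
    (fsqrt x).Exec ε z t ↔ |z - √x| ≤ ε * √x ∧ t = 1 := by
  simp only [fsqrt, Exec, abs_of_nonneg (Real.sqrt_nonneg x)]; grind

open Classical in
theorem exec_isLess {x y : ℝ} {b : Bool} {t : ℕ} :
    (isLess x y).Exec ε b t ↔ b = decide (x < y) ∧ t = 1 := by
  simp only [isLess, Exec]; grind

theorem Exec.tabulate {n : ℕ} {f : Fin n → Prog ℝ α} {g : Fin n → α} {t : ℕ}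
    (h : (tabulate f).Exec ε g t) :
    ∃ ts : Fin n → ℕ, (∀ i, (f i).Exec ε (g i) (ts i)) ∧ t = ∑ i, ts i := by
  induction n generalizing t with
  | zero =>
    obtain ⟨-, rfl⟩ := h
    exact ⟨0, fun i => i.elim0, rfl⟩
  | succ n ih =>
    simp only [Prog.tabulate, exec_bind, exec_pure] at h
    obtain ⟨a, s, _, ha, ⟨g', _, _, hg, ⟨rfl, rfl⟩, rfl⟩, rfl⟩ := h
    obtain ⟨ts, hts, rfl⟩ := ih hg
    exact ⟨Fin.cons s ts, Fin.cases ha hts, by simp [Fin.sum_univ_succ]⟩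

theorem Exec.foldlM_append {f : β → α → Prog ℝ β} (I : List α → β → ℕ → Prop)
    (step : ∀ l a b b' s u, I l b s → (f b a).Exec ε b' u → I (l ++ [a]) b' (s + u))
    (l pre : List α) {init b : β} {s t : ℕ} (hI : I pre init s)
    (h : (l.foldlM f init).Exec ε b t) : I (pre ++ l) b (s + t) := by
  induction l generalizing pre init s t with
  | nil =>
    obtain ⟨rfl, rfl⟩ := h
    simpa using hI
  | cons a l ih =>
    rw [List.foldlM_cons, exec_bind] at h
    obtain ⟨b', _, _, hb', h, rfl⟩ := h
    simpa [add_assoc] using ih (pre ++ [a]) (step pre a _ b' _ _ hI hb') h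

theorem Exec.foldlM {f : β → α → Prog ℝ β} (I : List α → β → ℕ → Prop)
    (step : ∀ l a b b' s u, I l b s → (f b a).Exec ε b' u → I (l ++ [a]) b' (s + u))
    {l : List α} {init b : β} {t : ℕ} (hI : I [] init 0)
    (h : (l.foldlM f init).Exec ε b t) : I l b t := by
  simpa using Exec.foldlM_append I step l [] hI h

end Prog

open Prog

section MatrixArithmetic

variable {ε : ℝ} {n m : ℕ} {A B S : Matrix (Fin n) (Fin m) ℝ} {t : ℕ}

theorem exec_matAdd (h : (matAdd A B).Exec ε S t) :
    (∀ i j, |S i j - (A + B) i j| ≤ ε * |(A + B) i j|) ∧ t = n * m := by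
  obtain ⟨ts, hts, rfl⟩ := h.tabulate
  choose us hus hts using fun i => (hts i).tabulate
  simp only [exec_fadd] at hus
  exact ⟨fun i j => (hus i j).1, by simp [hts, fun i j => (hus i j).2]⟩

theorem exec_matSub (h : (matSub A B).Exec ε S t) :
    (∀ i j, |S i j - (A - B) i j| ≤ ε * |(A - B) i j|) ∧ t = n * m := by
  obtain ⟨ts, hts, rfl⟩ := h.tabulate
  choose us hus hts using fun i => (hts i).tabulate
  simp only [exec_fsub] at hus
  exact ⟨fun i j => (hus i j).1, by simp [hts, fun i j => (hus i j).2]⟩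

end MatrixArithmetic

/-! ### Propagation of errors -/

theorem norm_sub_le_of_norm_sub_le_mul {E : Type*} [SeminormedAddCommGroup E] {x y z : E}
    {b e ε : ℝ} (hε : 0 ≤ ε) (hx : ‖x‖ ≤ b) (hyx : ‖y - x‖ ≤ e) (hzy : ‖z - y‖ ≤ ε * ‖y‖) :
    ‖z - x‖ ≤ e + ε * (b + e) := by
  have hy : ‖y‖ ≤ b + e := by linarith [norm_le_norm_add_norm_sub' y x]
  calc ‖z - x‖ ≤ ‖z - y‖ + ‖y - x‖ := norm_sub_le_norm_sub_add_norm_sub z y x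
    _ ≤ ε * (b + e) + e := add_le_add (hzy.trans (mul_le_mul_of_nonneg_left hy hε)) hyx
    _ = e + ε * (b + e) := add_comm _ _

theorem abs_sqrt_sub_sqrt_le {s S θ : ℝ} (hS : 0 ≤ S) (h : |s - S| ≤ θ * S) :
    |√s - √S| ≤ θ * √S := by
  obtain rfl | hS := hS.eq_or_lt
  · rw [show s = 0 by simpa using h]
    simp
  have hS' : 0 < √S := Real.sqrt_pos.2 hS
  rcases le_total 0 s with hs | hs
  · refine le_of_mul_le_mul_right ?_ hS'
    calc |√s - √S| * √S ≤ |√s - √S| * |√s + √S| := by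
          gcongr
          exact (le_add_of_nonneg_left (Real.sqrt_nonneg s)).trans (le_abs_self _)
      _ = |s - S| := by
          rw [← abs_mul, mul_comm, ← sq_sub_sq, Real.sq_sqrt hs, Real.sq_sqrt hS.le]
      _ ≤ θ * √S * √S := by rwa [mul_assoc, Real.mul_self_sqrt hS.le]
  · have hθ : 1 ≤ θ := by
      rw [abs_of_nonpos (by linarith)] at h
      nlinarith
    rw [Real.sqrt_eq_zero_of_nonpos hs, zero_sub, abs_neg, abs_of_pos hS']
    exact le_mul_of_one_le_left hS'.le hθ

theorem one_add_pow_le_one_add_two_mul {x : ℝ} (hx : 0 ≤ x) {n : ℕ} (h : 2 * n * x ≤ 1) :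
    (1 + x) ^ n ≤ 1 + 2 * n * x := by
  induction n with
  | zero => simp
  | succ n ih =>
    push_cast at h ⊢
    have hn : 2 * n * x ≤ 1 := by linarith
    calc (1 + x) ^ (n + 1) = (1 + x) ^ n * (1 + x) := pow_succ _ _
      _ ≤ (1 + 2 * n * x) * (1 + x) := by gcongr; exact ih hn
      _ = 1 + 2 * n * x + x + 2 * n * x * x := by ring
      _ ≤ 1 + 2 * (n + 1) * x := by nlinarith

/-! ### The spectral norm -/

section SpectralNorm

variable {𝕜 l m n : Type*} [RCLike 𝕜] [Fintype l] [Fintype m] [Fintype n]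
  [DecidableEq n]

theorem l2_opNorm_mul_le_of_le [DecidableEq m] {A : Matrix l m 𝕜} {B : Matrix m n 𝕜} {a b : ℝ}
    (hA : ‖A‖ ≤ a) (hB : ‖B‖ ≤ b) : ‖A * B‖ ≤ a * b :=
  (Matrix.l2_opNorm_mul A B).trans (mul_le_mul hA hB (norm_nonneg _) ((norm_nonneg _).trans hA))

theorem norm_entry_le_l2_opNorm (A : Matrix m n 𝕜) (i : m) (j : n) : ‖A i j‖ ≤ ‖A‖ := by
  calc ‖A i j‖ = ‖(WithLp.toLp 2 (A.mulVec (EuclideanSpace.single j (1 : 𝕜)).ofLp) :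
        EuclideanSpace 𝕜 m) i‖ := by simp
    _ ≤ ‖A‖ * ‖EuclideanSpace.single j (1 : 𝕜)‖ :=
        (PiLp.norm_apply_le _ i).trans (A.l2_opNorm_mulVec _)
    _ = ‖A‖ := by simp

theorem l2_opNorm_le_sqrt_sum_sq (A : Matrix m n 𝕜) : ‖A‖ ≤ √(∑ i, ∑ j, ‖A i j‖ ^ 2) := by
  rw [Matrix.l2_opNorm_def]
  refine ContinuousLinearMap.opNorm_le_bound _ (Real.sqrt_nonneg _) fun x => ?_
  have hrow (i : m) : ‖A.mulVec x.ofLp i‖ ^ 2 ≤ (∑ j, ‖A i j‖ ^ 2) * ∑ j, ‖x j‖ ^ 2 := by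
    calc ‖A.mulVec x.ofLp i‖ ^ 2 ≤ (∑ j, ‖A i j‖ * ‖x j‖) ^ 2 := by
          gcongr
          exact (norm_sum_le _ _).trans_eq (by simp only [norm_mul])
      _ ≤ _ := Finset.sum_mul_sq_le_sq_mul_sq _ _ _
  change ‖WithLp.toLp 2 (A.mulVec x.ofLp)‖ ≤ _
  rw [EuclideanSpace.norm_eq, EuclideanSpace.norm_eq, ← Real.sqrt_mul (by positivity),
    Finset.sum_mul]
  exact Real.sqrt_le_sqrt (Finset.sum_le_sum fun i _ => hrow i)

theorem l2_opNorm_le_mul_of_forall_norm_le {A : Matrix m n 𝕜} {c : ℝ} (hc : 0 ≤ c) {N : ℕ}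
    (hm : Fintype.card m ≤ N) (hn : Fintype.card n ≤ N) (h : ∀ i j, ‖A i j‖ ≤ c) :
    ‖A‖ ≤ N * c := by
  refine (l2_opNorm_le_sqrt_sum_sq A).trans (Real.sqrt_le_iff.2 ⟨by positivity, ?_⟩)
  calc ∑ i, ∑ j, ‖A i j‖ ^ 2 ≤ ∑ _i : m, ∑ _j : n, c ^ 2 := by gcongr; exact h _ _
    _ = Fintype.card m * (Fintype.card n * c ^ 2) := by simp
    _ ≤ N * (N * c ^ 2) := by gcongr
    _ = (N * c) ^ 2 := by ring

theorem l2_opNorm_sub_le_of_entrywise {S A : Matrix m n 𝕜} {ε : ℝ} (hε : 0 ≤ ε) {N : ℕ}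
    (hm : Fintype.card m ≤ N) (hn : Fintype.card n ≤ N)
    (h : ∀ i j, ‖S i j - A i j‖ ≤ ε * ‖A i j‖) : ‖S - A‖ ≤ N * ε * ‖A‖ := by
  rw [mul_assoc]
  exact l2_opNorm_le_mul_of_forall_norm_le (by positivity) hm hn fun i j =>
    (h i j).trans (mul_le_mul_of_nonneg_left (norm_entry_le_l2_opNorm A i j) hε)

theorem l2_opNorm_transpose [DecidableEq m] (A : Matrix m n ℝ) : ‖A.transpose‖ = ‖A‖ := by
  rw [← Matrix.l2_opNorm_conjTranspose A, Matrix.conjTranspose_eq_transpose_of_trivial]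

theorem l2_opNorm_one_le : ‖(1 : Matrix n n 𝕜)‖ ≤ 1 := by
  rw [← Matrix.diagonal_one, Matrix.l2_opNorm_diagonal]
  exact (pi_norm_le_iff_of_nonneg zero_le_one).2 fun i => by simp

theorem l2_opNorm_le_one_of_transpose_mul_self {U : Matrix m n ℝ} (h : U.transpose * U = 1) :
    ‖U‖ ≤ 1 := by
  have hU := Matrix.l2_opNorm_conjTranspose_mul_self U
  rw [Matrix.conjTranspose_eq_transpose_of_trivial, h] at hU
  nlinarith [l2_opNorm_one_le (𝕜 := ℝ) (n := n), norm_nonneg U]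

theorem l2_opNorm_le_one_of_mem_orthogonalGroup {Q : Matrix n n ℝ}
    (hQ : Q ∈ Matrix.orthogonalGroup n ℝ) : ‖Q‖ ≤ 1 :=
  l2_opNorm_le_one_of_transpose_mul_self ((Matrix.mem_orthogonalGroup_iff' _ _).1 hQ)

theorem l2_opNorm_replicateCol [Unique l] [DecidableEq l] (x : m → 𝕜) :
    ‖Matrix.replicateCol l x‖ = ‖WithLp.toLp 2 x‖ := by
  apply le_antisymm
  · simpa [EuclideanSpace.norm_eq] using l2_opNorm_le_sqrt_sum_sq (Matrix.replicateCol l x)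
  · have hcol : (Matrix.replicateCol l x).mulVec (Pi.single default 1) = x := by
      ext i
      simp
    simpa [hcol] using
      (Matrix.replicateCol l x).l2_opNorm_mulVec (EuclideanSpace.single default (1 : 𝕜))

theorem l2_opNorm_replicateRow [Unique l] (x : n → ℝ) :
    ‖Matrix.replicateRow l x‖ = ‖WithLp.toLp 2 x‖ := by
  classical
  rw [← Matrix.transpose_replicateCol, l2_opNorm_transpose, l2_opNorm_replicateCol]

theorem l2_opNorm_vecMulVec_le (x : m → ℝ) (y : n → ℝ) :
    ‖Matrix.vecMulVec x y‖ ≤ ‖WithLp.toLp 2 x‖ * ‖WithLp.toLp 2 y‖ := by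
  rw [Matrix.vecMulVec_eq Unit]
  exact l2_opNorm_mul_le_of_le (l2_opNorm_replicateCol x).le (l2_opNorm_replicateRow y).le

end SpectralNorm

/-! ### Block matrices -/

section Blocks

variable {n m a : ℕ}

section CommSemiring

variable (R : Type) [CommSemiring R]

/-- The `n`-by-`a` matrix `[I; 0]`. Together with `botEmb` it expresses all block operations as
matrix products. -/
def topEmb (h : a ≤ n) : Matrix (Fin n) (Fin a) R :=
  (1 : Matrix (Fin n) (Fin n) R).submatrix id (Fin.castLE h)

/-- The `n`-by-`(n - a)` matrix `[0; I]`, the companion of `topEmb`. -/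
def botEmb (h : a ≤ n) : Matrix (Fin n) (Fin (n - a)) R :=
  (1 : Matrix (Fin n) (Fin n) R).submatrix id (upperIdx h)

variable {R}

theorem castLE_or_upperIdx (h : a ≤ n) (i : Fin n) :
    (∃ j, i = Fin.castLE h j) ∨ ∃ j, i = upperIdx h j := by
  by_cases hi : i.val < a
  · exact Or.inl ⟨⟨i, hi⟩, rfl⟩
  · exact Or.inr ⟨⟨i - a, by omega⟩, Fin.ext (by simp [upperIdx]; omega)⟩

theorem upperIdx_inj {h : a ≤ n} {i j : Fin (n - a)} : upperIdx h i = upperIdx h j ↔ i = j := by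
  simp [upperIdx, Fin.ext_iff]

theorem castLE_ne_upperIdx (h : a ≤ n) (i : Fin a) (j : Fin (n - a)) :
    Fin.castLE h i ≠ upperIdx h j := by
  simp [upperIdx, Fin.ext_iff]
  omega

theorem glue_castLE {α : Type} (h : a ≤ n) (f : Fin a → α) (g : Fin (n - a) → α) (i : Fin a) :
    glue f g (Fin.castLE h i) = f i := by
  simp [glue]

theorem glue_upperIdx {α : Type} (h : a ≤ n) (f : Fin a → α) (g : Fin (n - a) → α)
    (i : Fin (n - a)) : glue f g (upperIdx h i) = g i := by
  simp [glue, upperIdx]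

theorem leftCols_eq (h : a ≤ m) (A : Matrix (Fin n) (Fin m) R) : leftCols h A = A * topEmb R h := by
  ext i j
  simp [leftCols, topEmb, Matrix.mul_apply, Matrix.one_apply]

theorem rightCols_eq (h : a ≤ m) (A : Matrix (Fin n) (Fin m) R) :
    rightCols h A = A * botEmb R h := by
  ext i j
  simp [rightCols, botEmb, Matrix.mul_apply, Matrix.one_apply]

theorem topRows_eq (h : a ≤ n) (A : Matrix (Fin n) (Fin m) R) :
    topRows h A = (topEmb R h).transpose * A := by
  ext i j
  simp [topRows, topEmb, Matrix.mul_apply, Matrix.one_apply]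

theorem bottomRows_eq (h : a ≤ n) (A : Matrix (Fin n) (Fin m) R) :
    bottomRows h A = (botEmb R h).transpose * A := by
  ext i j
  simp [bottomRows, botEmb, Matrix.mul_apply, Matrix.one_apply]

theorem leftCols_mul (h : a ≤ m) {k : ℕ} (B : Matrix (Fin k) (Fin n) R)
    (A : Matrix (Fin n) (Fin m) R) : leftCols h (B * A) = B * leftCols h A := by
  rw [leftCols_eq, leftCols_eq, Matrix.mul_assoc]

theorem rightCols_mul (h : a ≤ m) {k : ℕ} (B : Matrix (Fin k) (Fin n) R)
    (A : Matrix (Fin n) (Fin m) R) : rightCols h (B * A) = B * rightCols h A := by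
  rw [rightCols_eq, rightCols_eq, Matrix.mul_assoc]

theorem topEmb_transpose_mul_topEmb (h : a ≤ n) :
    (topEmb R h).transpose * topEmb R h = 1 := by
  rw [← topRows_eq]
  ext i j
  simp [topRows, topEmb, Matrix.one_apply]

theorem botEmb_transpose_mul_botEmb (h : a ≤ n) :
    (botEmb R h).transpose * botEmb R h = 1 := by
  rw [← bottomRows_eq]
  ext i j
  simp [bottomRows, botEmb, Matrix.one_apply, upperIdx_inj]

theorem botEmb_transpose_mul_topEmb (h : a ≤ n) :
    (botEmb R h).transpose * topEmb R h = 0 := by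
  rw [← bottomRows_eq]
  ext i j
  simp [bottomRows, topEmb, (castLE_ne_upperIdx h _ _).symm]

theorem topEmb_transpose_mul_botEmb (h : a ≤ n) :
    (topEmb R h).transpose * botEmb R h = 0 := by
  simpa using congrArg Matrix.transpose (botEmb_transpose_mul_topEmb (R := R) h)

theorem topEmb_mul_transpose_add_botEmb_mul_transpose (h : a ≤ n) :
    topEmb R h * (topEmb R h).transpose + botEmb R h * (botEmb R h).transpose = 1 := by
  ext i j
  obtain ⟨i, rfl⟩ | ⟨i, rfl⟩ := castLE_or_upperIdx h i <;>
    obtain ⟨j, rfl⟩ | ⟨j, rfl⟩ := castLE_or_upperIdx h j <;>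
    simp [topEmb, botEmb, Matrix.mul_apply, Matrix.one_apply, upperIdx_inj, castLE_ne_upperIdx,
      (castLE_ne_upperIdx h _ _).symm]

theorem topEmb_mul_topEmb {k : ℕ} (hkm : k ≤ m) (hmn : m ≤ n) :
    topEmb R hmn * topEmb R hkm = topEmb R (hkm.trans hmn) := by
  rw [← leftCols_eq]
  rfl

theorem topEmb_mul_botEmb {k : ℕ} (hkm : k ≤ m) (hmn : m ≤ n) :
    topEmb R hmn * botEmb R hkm =
      botEmb R (hkm.trans hmn) * topEmb R (Nat.sub_le_sub_right hmn k) := by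
  rw [← rightCols_eq, ← leftCols_eq]
  rfl

theorem topEmb_mul_topRows_add_botEmb_mul_bottomRows (h : a ≤ n) (A : Matrix (Fin n) (Fin m) R) :
    topEmb R h * topRows h A + botEmb R h * bottomRows h A = A := by
  rw [topRows_eq, bottomRows_eq, ← Matrix.mul_assoc, ← Matrix.mul_assoc, ← Matrix.add_mul,
    topEmb_mul_transpose_add_botEmb_mul_transpose, Matrix.one_mul]

theorem leftCols_mul_add_rightCols_mul (h : a ≤ m) (A : Matrix (Fin n) (Fin m) R) :
    leftCols h A * (topEmb R h).transpose + rightCols h A * (botEmb R h).transpose = A := by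
  rw [leftCols_eq, rightCols_eq, Matrix.mul_assoc, Matrix.mul_assoc, ← Matrix.mul_add,
    topEmb_mul_transpose_add_botEmb_mul_transpose, Matrix.mul_one]

theorem vcat_eq (h : a ≤ n) (A : Matrix (Fin a) (Fin m) R) (B : Matrix (Fin (n - a)) (Fin m) R) :
    (vcat A B : Matrix (Fin n) (Fin m) R) = topEmb R h * A + botEmb R h * B := by
  have htop : topRows h (vcat A B) = A := by
    ext i j
    exact glue_castLE h (fun i => A i j) (fun i => B i j) i
  have hbottom : bottomRows h (vcat A B) = B := by
    ext i j
    exact glue_upperIdx h (fun i => A i j) (fun i => B i j) i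
  rw [← topEmb_mul_topRows_add_botEmb_mul_bottomRows h (vcat A B), htop, hbottom]

theorem hcat_eq (h : a ≤ m) (A : Matrix (Fin n) (Fin a) R) (B : Matrix (Fin n) (Fin (m - a)) R) :
    (hcat A B : Matrix (Fin n) (Fin m) R) =
      A * (topEmb R h).transpose + B * (botEmb R h).transpose := by
  have hvcat : (hcat A B : Matrix (Fin n) (Fin m) R) =
      (vcat A.transpose B.transpose).transpose := rfl
  simp [hvcat, vcat_eq h]

theorem vcat_hcat_zero_eq {k : ℕ} (hkm : k ≤ m) (hmn : m ≤ n) (A : Matrix (Fin k) (Fin k) R)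
    (B : Matrix (Fin k) (Fin (m - k)) R) (C : Matrix (Fin (m - k)) (Fin (m - k)) R) :
    (vcat (vcat (hcat A B) (hcat 0 C) : Matrix (Fin m) (Fin m) R) 0 : Matrix (Fin n) (Fin m) R) =
      hcat (vcat A 0) (vcat B (vcat C 0)) := by
  simp only [vcat_eq hmn, vcat_eq hkm, vcat_eq (hkm.trans hmn), hcat_eq hkm,
    vcat_eq (Nat.sub_le_sub_right hmn k), Matrix.mul_zero, Matrix.zero_mul, add_zero, zero_add,
    Matrix.mul_add, Matrix.add_mul, ← Matrix.mul_assoc, topEmb_mul_topEmb, topEmb_mul_botEmb]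
  abel

theorem vcat_zero (h : a ≤ n) (A : Matrix (Fin a) (Fin m) R) :
    (vcat A 0 : Matrix (Fin n) (Fin m) R) = topEmb R h * A := by
  rw [vcat_eq h, Matrix.mul_zero, add_zero]

/-- The `n`-by-`n` matrix `[I, 0; 0, Q]`, which lets a transformation of the last `n - a`
coordinates act on the whole space. -/
def diagOne (h : a ≤ n) (Q : Matrix (Fin (n - a)) (Fin (n - a)) R) : Matrix (Fin n) (Fin n) R :=
  topEmb R h * (topEmb R h).transpose + botEmb R h * Q * (botEmb R h).transpose

theorem diagOne_mul (h : a ≤ n) (Q : Matrix (Fin (n - a)) (Fin (n - a)) R)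
    (A : Matrix (Fin n) (Fin m) R) :
    diagOne h Q * A = topEmb R h * topRows h A + botEmb R h * (Q * bottomRows h A) := by
  simp only [diagOne, Matrix.add_mul, topRows_eq, bottomRows_eq, Matrix.mul_assoc]

theorem diagOne_mul_topEmb (h : a ≤ n) (Q : Matrix (Fin (n - a)) (Fin (n - a)) R) :
    diagOne h Q * topEmb R h = topEmb R h := by
  simp [diagOne_mul, topRows_eq, bottomRows_eq, topEmb_transpose_mul_topEmb,
    botEmb_transpose_mul_topEmb]

end CommSemiring

theorem diagOne_mem_orthogonalGroup {R : Type} [CommRing R] (h : a ≤ n)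
    {Q : Matrix (Fin (n - a)) (Fin (n - a)) R}
    (hQ : Q ∈ Matrix.orthogonalGroup (Fin (n - a)) R) :
    diagOne h Q ∈ Matrix.orthogonalGroup (Fin n) R := by
  rw [Matrix.mem_orthogonalGroup_iff] at hQ ⊢
  have htop : topRows h (diagOne h Q).transpose = (topEmb R h).transpose := by
    rw [topRows_eq, ← Matrix.transpose_mul, diagOne_mul_topEmb]
  have hbottom : bottomRows h (diagOne h Q).transpose = Q.transpose * (botEmb R h).transpose := by
    rw [bottomRows_eq, ← Matrix.transpose_mul, ← Matrix.transpose_mul, diagOne_mul, topRows_eq,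
      bottomRows_eq, topEmb_transpose_mul_botEmb, botEmb_transpose_mul_botEmb, Matrix.mul_zero,
      zero_add, Matrix.mul_one]
  rw [diagOne_mul, htop, hbottom, ← Matrix.mul_assoc Q, hQ, Matrix.one_mul,
    topEmb_mul_transpose_add_botEmb_mul_transpose]

section Norm

variable (h : a ≤ n)

theorem norm_topEmb_le_one : ‖topEmb ℝ h‖ ≤ 1 :=
  l2_opNorm_le_one_of_transpose_mul_self (topEmb_transpose_mul_topEmb h)

theorem norm_botEmb_le_one : ‖botEmb ℝ h‖ ≤ 1 :=
  l2_opNorm_le_one_of_transpose_mul_self (botEmb_transpose_mul_botEmb h)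

theorem norm_topEmb_mul_le (A : Matrix (Fin a) (Fin m) ℝ) : ‖topEmb ℝ h * A‖ ≤ ‖A‖ := by
  simpa using l2_opNorm_mul_le_of_le (norm_topEmb_le_one h) le_rfl (B := A)

theorem norm_botEmb_mul_le (A : Matrix (Fin (n - a)) (Fin m) ℝ) : ‖botEmb ℝ h * A‖ ≤ ‖A‖ := by
  simpa using l2_opNorm_mul_le_of_le (norm_botEmb_le_one h) le_rfl (B := A)

theorem norm_mul_topEmb_transpose_le (A : Matrix (Fin m) (Fin a) ℝ) :
    ‖A * (topEmb ℝ h).transpose‖ ≤ ‖A‖ := by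
  rw [← l2_opNorm_transpose, ← l2_opNorm_transpose A, Matrix.transpose_mul,
    Matrix.transpose_transpose]
  exact norm_topEmb_mul_le h _

theorem norm_mul_botEmb_transpose_le (A : Matrix (Fin m) (Fin (n - a)) ℝ) :
    ‖A * (botEmb ℝ h).transpose‖ ≤ ‖A‖ := by
  rw [← l2_opNorm_transpose, ← l2_opNorm_transpose A, Matrix.transpose_mul,
    Matrix.transpose_transpose]
  exact norm_botEmb_mul_le h _

theorem norm_leftCols_le (A : Matrix (Fin m) (Fin n) ℝ) : ‖leftCols h A‖ ≤ ‖A‖ := by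
  rw [leftCols_eq]
  simpa using l2_opNorm_mul_le_of_le (le_refl ‖A‖) (norm_topEmb_le_one h)

theorem norm_rightCols_le (A : Matrix (Fin m) (Fin n) ℝ) : ‖rightCols h A‖ ≤ ‖A‖ := by
  rw [rightCols_eq]
  simpa using l2_opNorm_mul_le_of_le (le_refl ‖A‖) (norm_botEmb_le_one h)

theorem norm_bottomRows_le (A : Matrix (Fin n) (Fin m) ℝ) : ‖bottomRows h A‖ ≤ ‖A‖ := by
  rw [bottomRows_eq, ← l2_opNorm_transpose A, ← l2_opNorm_transpose, Matrix.transpose_mul,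
    Matrix.transpose_transpose, ← rightCols_eq]
  exact norm_rightCols_le h _

theorem norm_diagOne_sub_diagOne_le (P Q : Matrix (Fin (n - a)) (Fin (n - a)) ℝ) :
    ‖diagOne h P - diagOne h Q‖ ≤ ‖P - Q‖ := by
  rw [diagOne, diagOne, add_sub_add_left_eq_sub, ← Matrix.sub_mul, ← Matrix.mul_sub]
  exact (norm_mul_botEmb_transpose_le h _).trans (norm_botEmb_mul_le h _)

end Norm

theorem norm_vcat_le (h : a ≤ n) (A : Matrix (Fin a) (Fin m) ℝ)
    (B : Matrix (Fin (n - a)) (Fin m) ℝ) :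
    ‖(vcat A B : Matrix (Fin n) (Fin m) ℝ)‖ ≤ ‖A‖ + ‖B‖ := by
  rw [vcat_eq h]
  exact norm_add_le_of_le (norm_topEmb_mul_le h A) (norm_botEmb_mul_le h B)

theorem norm_hcat_le (h : a ≤ n) (A : Matrix (Fin m) (Fin a) ℝ)
    (B : Matrix (Fin m) (Fin (n - a)) ℝ) :
    ‖(hcat A B : Matrix (Fin m) (Fin n) ℝ)‖ ≤ ‖A‖ + ‖B‖ := by
  rw [hcat_eq h]
  exact norm_add_le_of_le (norm_mul_topEmb_transpose_le h A) (norm_mul_botEmb_transpose_le h B)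

theorem norm_sub_hcat_le (h : a ≤ n) (A : Matrix (Fin m) (Fin n) ℝ)
    (L : Matrix (Fin m) (Fin a) ℝ) (R : Matrix (Fin m) (Fin (n - a)) ℝ) :
    ‖A - hcat L R‖ ≤ ‖leftCols h A - L‖ + ‖rightCols h A - R‖ := by
  have hsub : A - hcat L R = hcat (leftCols h A - L) (rightCols h A - R) := by
    rw [hcat_eq h, hcat_eq h, Matrix.sub_mul, Matrix.sub_mul, sub_add_sub_comm,
      leftCols_mul_add_rightCols_mul]
  rw [hsub]
  exact norm_hcat_le h _ _

end Blocks

/-! ### Rectangular matrix multiplication -/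

namespace MatMul

/-- With machine epsilon `ε`, the routine multiplies square matrices of order at most `N` with a
normwise relative error of at most `μ`. -/
def IsAccurate (mm : MatMul) (N : ℕ) (ε μ : ℝ) : Prop :=
  ∀ k : ℕ, 1 ≤ k → k ≤ N → ∀ (A B P : Matrix (Fin k) (Fin k) ℝ) (t : ℕ),
    (mm ℝ k A B).Exec ε P t → ‖P - A * B‖ ≤ μ * (‖A‖ * ‖B‖)

/-- With machine epsilon `ε`, the block algorithm `rectMul` based on the routine multiplies
rectangular matrices with dimensions at most `N` with a normwise relative error of at most `κ`. -/
def IsRectAccurate (mm : MatMul) (N : ℕ) (ε κ : ℝ) : Prop :=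
  ∀ p q r : ℕ, p ≤ N → q ≤ N → r ≤ N → ∀ (A : Matrix (Fin p) (Fin q) ℝ)
    (B : Matrix (Fin q) (Fin r) ℝ) (P : Matrix (Fin p) (Fin r) ℝ) (t : ℕ),
    (rectMul mm A B).Exec ε P t → ‖P - A * B‖ ≤ κ * (‖A‖ * ‖B‖)

end MatMul

/-- The loop of `rectMul` that computes one block of the product, `Z + X 0 * Y 0 + ⋯`. -/
def blockSum (mm : MatMul) {V : Type} {k : ℕ} (b : ℕ) (Z : Matrix (Fin k) (Fin k) V)
    (X Y : ℕ → Matrix (Fin k) (Fin k) V) : Prog V (Matrix (Fin k) (Fin k) V) :=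
  (List.range b).foldlM (init := Z) fun acc K => do
    let P ← mm V k (X K) (Y K)
    matAdd acc P

section RectMul

variable {mm : MatMul} {p q r k N : ℕ} {ε μ : ℝ}

theorem exec_rectMul {A : Matrix (Fin p) (Fin q) ℝ} {B : Matrix (Fin q) (Fin r) ℝ}
    {P : Matrix (Fin p) (Fin r) ℝ} {t : ℕ} (hk : k = min p (min q r)) (hk0 : 0 < k)
    (h : (rectMul mm A B).Exec ε P t) :
    ∃ (S : Fin ((p + k - 1) / k) → Fin ((r + k - 1) / k) → Matrix (Fin k) (Fin k) ℝ)
      (ts : Fin ((p + k - 1) / k) → Fin ((r + k - 1) / k) → ℕ),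
      (∀ (I : Fin ((p + k - 1) / k)) (J : Fin ((r + k - 1) / k)),
        (blockSum mm ((q + k - 1) / k) 0 (fun K => paddedBlock k 0 A I K)
          (fun K => paddedBlock k 0 B K J)).Exec ε (S I J) (ts I J)) ∧
      (∀ i j, P i j = S ⟨i / k, div_lt_ceilDiv hk0 i.isLt⟩ ⟨j / k, div_lt_ceilDiv hk0 j.isLt⟩
        ⟨i % k, Nat.mod_lt _ hk0⟩ ⟨j % k, Nat.mod_lt _ hk0⟩) ∧
      t = ∑ I, ∑ J, ts I J := by
  subst hk
  simp only [rectMul, exec_bind, exec_literal, dif_pos hk0, exec_pure] at h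
  obtain ⟨_, _, _, ⟨rfl, rfl⟩, ⟨S, s, _, hS, ⟨rfl, rfl⟩, rfl⟩, rfl⟩ := h
  obtain ⟨ts, hts, rfl⟩ := hS.tabulate
  choose us hus hts using fun I => (hts I).tabulate
  exact ⟨S, us, hus, fun i j => rfl, by simp [hts]⟩

theorem exec_rectMul_of_min_eq_zero {A : Matrix (Fin p) (Fin q) ℝ} {B : Matrix (Fin q) (Fin r) ℝ}
    {P : Matrix (Fin p) (Fin r) ℝ} {t : ℕ} (hk : min p (min q r) = 0)
    (h : (rectMul mm A B).Exec ε P t) : P = A * B ∧ t = 0 := by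
  simp only [rectMul, exec_bind, exec_literal, dif_neg hk.not_gt, exec_pure] at h
  obtain ⟨_, _, _, ⟨rfl, rfl⟩, ⟨rfl, rfl⟩, rfl⟩ := h
  refine ⟨?_, rfl⟩
  ext i j
  obtain rfl : q = 0 := by
    have := i.isLt
    have := j.isLt
    omega
  simp [constMat, Matrix.mul_apply]

theorem norm_matAdd_sub_le {n m : ℕ} {A B S T : Matrix (Fin n) (Fin m) ℝ} {t : ℕ} {b e : ℝ}
    (hε : 0 ≤ ε) (hn : n ≤ N) (hm : m ≤ N) (hT : ‖T‖ ≤ b) (he : ‖A + B - T‖ ≤ e)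
    (h : (matAdd A B).Exec ε S t) : ‖S - T‖ ≤ e + N * ε * (b + e) :=
  norm_sub_le_of_norm_sub_le_mul (by positivity) hT he
    (l2_opNorm_sub_le_of_entrywise hε (by simpa) (by simpa) (exec_matAdd h).1)

theorem norm_matSub_sub_le {n m : ℕ} {A B S T : Matrix (Fin n) (Fin m) ℝ} {t : ℕ} {b e : ℝ}
    (hε : 0 ≤ ε) (hn : n ≤ N) (hm : m ≤ N) (hT : ‖T‖ ≤ b) (he : ‖A - B - T‖ ≤ e)
    (h : (matSub A B).Exec ε S t) : ‖S - T‖ ≤ e + N * ε * (b + e) :=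
  norm_sub_le_of_norm_sub_le_mul (by positivity) hT he
    (l2_opNorm_sub_le_of_entrywise hε (by simpa) (by simpa) (exec_matSub h).1)

theorem norm_blockSum_sub_le {b : ℕ} {D x y : ℝ} {X Y : ℕ → Matrix (Fin k) (Fin k) ℝ}
    {S : Matrix (Fin k) (Fin k) ℝ} {t : ℕ} (hε : 0 ≤ ε) (hμ : 0 ≤ μ) (hk : 1 ≤ k)
    (hmm : mm.IsAccurate k ε μ) (hD0 : 0 ≤ D) (hD : μ + k * ε * (b * (1 + D)) ≤ D)
    (hX : ∀ K, ‖X K‖ ≤ x) (hY : ∀ K, ‖Y K‖ ≤ y) (h : (blockSum mm b 0 X Y).Exec ε S t) :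
    ‖S - ∑ K ∈ Finset.range b, X K * Y K‖ ≤ b * D * (x * y) := by
  have hx : 0 ≤ x := (norm_nonneg _).trans (hX 0)
  have hxy : 0 ≤ x * y := mul_nonneg hx ((norm_nonneg _).trans (hY 0))
  suffices b ≤ b → ‖((List.range b).map fun K => X K * Y K).sum‖ ≤ b * (x * y) ∧
      ‖S - ((List.range b).map fun K => X K * Y K).sum‖ ≤ b * D * (x * y) from (this le_rfl).2
  have hloop := Exec.foldlM (fun l S _ => l.length ≤ b →
    ‖(l.map fun K => X K * Y K).sum‖ ≤ l.length * (x * y) ∧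
    ‖S - (l.map fun K => X K * Y K).sum‖ ≤ l.length * D * (x * y)) ?_ (by simp) h
  · simpa only [List.length_range] using hloop
  intro l K S S' _ u ih hS' hl
  simp only [exec_bind] at hS'
  obtain ⟨P, _, _, hP, hS', rfl⟩ := hS'
  simp only [List.length_append, List.length_singleton] at hl
  obtain ⟨hT, hST⟩ := ih (by omega)
  simp only [List.length_append, List.length_singleton, List.map_append, List.sum_append,
    List.map_singleton, List.sum_singleton, Nat.cast_add, Nat.cast_one]
  set T := (l.map fun K => X K * Y K).sum
  have hT' : ‖T + X K * Y K‖ ≤ (l.length + 1) * (x * y) :=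
    (norm_add_le_of_le hT (l2_opNorm_mul_le_of_le (hX K) (hY K))).trans_eq (by ring)
  have hPe : ‖P - X K * Y K‖ ≤ μ * (x * y) := by
    refine (hmm k hk le_rfl _ _ _ _ hP).trans ?_
    gcongr
    exacts [hX K, hY K]
  have hSP : ‖S + P - (T + X K * Y K)‖ ≤ (l.length * D + μ) * (x * y) := by
    rw [add_sub_add_comm]
    exact (norm_add_le_of_le hST hPe).trans_eq (by ring)
  refine ⟨hT', (norm_matAdd_sub_le hε le_rfl le_rfl hT' hSP hS').trans ?_⟩
  have hl' : (l.length + 1 : ℝ) ≤ b := by exact_mod_cast hl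
  have hμD : μ ≤ D := le_of_add_le_of_nonneg_left hD (by positivity)
  calc (l.length * D + μ) * (x * y) +
        k * ε * ((l.length + 1) * (x * y) + (l.length * D + μ) * (x * y))
      ≤ (l.length * D + μ) * (x * y) +
        k * ε * ((l.length + 1) * (x * y) + (l.length * D + D) * (x * y)) := by gcongr
    _ = (l.length * D + (μ + k * ε * ((l.length + 1) * (1 + D)))) * (x * y) := by ring
    _ ≤ (l.length * D + (μ + k * ε * (b * (1 + D)))) * (x * y) := by gcongr
    _ ≤ (l.length * D + D) * (x * y) := by gcongr
    _ = (l.length + 1) * D * (x * y) := by ring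

theorem norm_paddedBlock_le (A : Matrix (Fin p) (Fin q) ℝ) (I J : ℕ) :
    ‖paddedBlock k 0 A I J‖ ≤ k * ‖A‖ := by
  refine l2_opNorm_le_mul_of_forall_norm_le (norm_nonneg A) (by simp) (by simp) fun i j => ?_
  simp only [paddedBlock, Matrix.of_apply]
  split_ifs
  · exact norm_entry_le_l2_opNorm _ _ _
  · simp

theorem sum_range_mul_eq {M : Type*} [AddCommMonoid M] (f : ℕ → M) (b k : ℕ) :
    ∑ s ∈ Finset.range (b * k), f s =
      ∑ K ∈ Finset.range b, ∑ κ ∈ Finset.range k, f (K * k + κ) := by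
  induction b with
  | zero => simp
  | succ b ih => rw [Nat.succ_mul, Finset.sum_range_add, ih, Finset.sum_range_succ]

theorem mul_apply_eq_sum_paddedBlock {R : Type} [CommSemiring R] (hk : 0 < k)
    (A : Matrix (Fin p) (Fin q) R) (B : Matrix (Fin q) (Fin r) R) (i : Fin p) (j : Fin r) :
    (A * B) i j = (∑ K ∈ Finset.range ((q + k - 1) / k),
      paddedBlock k 0 A (i / k) K * paddedBlock k 0 B K (j / k))
        ⟨i % k, Nat.mod_lt _ hk⟩ ⟨j % k, Nat.mod_lt _ hk⟩ := by
  let f : ℕ → R := fun s => if hs : s < q then A i ⟨s, hs⟩ * B ⟨s, hs⟩ j else 0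
  have hq : q ≤ (q + k - 1) / k * k := by
    rw [mul_comm]
    exact le_smul_ceilDiv hk
  have hi : i.val / k * k + i.val % k = i.val := Nat.div_add_mod' _ _
  have hj : j.val / k * k + j.val % k = j.val := Nat.div_add_mod' _ _
  calc (A * B) i j = ∑ s ∈ Finset.range q, f s := by
        simp [Matrix.mul_apply, Finset.sum_range, f]
    _ = ∑ s ∈ Finset.range ((q + k - 1) / k * k), f s := by
        refine Finset.sum_subset (Finset.range_mono hq) fun s _ hs => ?_
        simp only [Finset.mem_range] at hs
        simp [f, hs]
    _ = ∑ K ∈ Finset.range ((q + k - 1) / k), ∑ κ : Fin k, f (K * k + κ) := by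
        rw [sum_range_mul_eq]
        exact Finset.sum_congr rfl fun K _ => Finset.sum_range _
    _ = _ := by
        simp only [Matrix.sum_apply, Matrix.mul_apply]
        refine Finset.sum_congr rfl fun K _ => Finset.sum_congr rfl fun κ _ => ?_
        simp only [paddedBlock, Matrix.of_apply, hi, hj, i.isLt, j.isLt, true_and, and_true, f]
        split_ifs <;> simp

theorem MatMul.IsAccurate.isRectAccurate (hε : 0 ≤ ε) (hμ : 0 ≤ μ)
    (hmm : mm.IsAccurate N ε μ) (hsmall : μ + 2 * N ^ 2 * ε ≤ 1) :
    mm.IsRectAccurate N ε (N ^ 4 * (μ + 2 * N ^ 2 * ε)) := by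
  intro p q r hp hq hr A B P t hP
  rcases Nat.eq_zero_or_pos (min p (min q r)) with hk | hk
  · rw [(exec_rectMul_of_min_eq_zero hk hP).1, sub_self, norm_zero]
    positivity
  obtain ⟨k, hkdef⟩ : ∃ k, k = min p (min q r) := ⟨_, rfl⟩
  rw [← hkdef] at hk
  have hkN : k ≤ N := by omega
  have hbN : (q + k - 1) / k ≤ N :=
    ((ceilDiv_le_iff_le_mul hk).2 (Nat.le_mul_of_pos_left q hk)).trans hq
  have hD : μ + k * ε * (((q + k - 1) / k : ℕ) * (1 + (μ + 2 * N ^ 2 * ε))) ≤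
      μ + 2 * N ^ 2 * ε := by
    calc _ ≤ μ + N * ε * (N * (1 + 1)) := by gcongr
      _ = _ := by ring
  obtain ⟨S, ts, hS, hPS, -⟩ := exec_rectMul hkdef hk hP
  have hentry (i : Fin p) (j : Fin r) :
      ‖(P - A * B) i j‖ ≤ N * (μ + 2 * N ^ 2 * ε) * ((N * ‖A‖) * (N * ‖B‖)) := by
    rw [Matrix.sub_apply, hPS, mul_apply_eq_sum_paddedBlock hk, ← Matrix.sub_apply]
    refine (norm_entry_le_l2_opNorm _ _ _).trans ((norm_blockSum_sub_le hε hμ hk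
      (fun l hl hlk => hmm l hl (hlk.trans hkN)) (by positivity) hD
      (fun K => norm_paddedBlock_le A _ K) (fun K => norm_paddedBlock_le B K _) (hS _ _)).trans ?_)
    gcongr
  calc ‖P - A * B‖ ≤ N * (N * (μ + 2 * N ^ 2 * ε) * ((N * ‖A‖) * (N * ‖B‖))) :=
        l2_opNorm_le_mul_of_forall_norm_le (by positivity) (by simpa) (by simpa) hentry
    _ = N ^ 4 * (μ + 2 * N ^ 2 * ε) * (‖A‖ * ‖B‖) := by ring

end RectMul

/-! ### One level of the recursion -/

/-- The program by which `qrr` applies a transformation `I - W Y` to a matrix `B`: it computes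
`B - W (Y B)`. -/
def wyApply (mm : MatMul) {V : Type} {n m r : ℕ} (W : Matrix (Fin n) (Fin m) V)
    (Y : Matrix (Fin m) (Fin n) V) (B : Matrix (Fin n) (Fin r) V) :
    Prog V (Matrix (Fin n) (Fin r) V) := do
  let YB ← rectMul mm Y B
  let WYB ← rectMul mm W YB
  matSub B WYB

section Recursion

variable {mm : MatMul} {n m l N : ℕ} {ε : ℝ}

theorem exec_qrr_zero {h : 0 ≤ n} {A : Matrix (Fin n) (Fin 0) ℝ} {out} {t : ℕ}
    (hqrr : (qrr mm n 0 h A).Exec ε out t) : t = 0 := by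
  rw [qrr] at hqrr
  exact hqrr.2

theorem exec_qrr_one {h : 1 ≤ n} {A : Matrix (Fin n) (Fin 1) ℝ} {R : Matrix (Fin 1) (Fin 1) ℝ}
    {W : Matrix (Fin n) (Fin 1) ℝ} {Y : Matrix (Fin 1) (Fin n) ℝ} {t : ℕ}
    (hqrr : (qrr mm n 1 h A).Exec ε (R, W, Y) t) :
    ∃ ρ w y, (householder h fun i => A i 0).Exec ε (ρ, w, y) t ∧
      R = (Matrix.of fun _ _ => ρ) ∧ W = Matrix.replicateCol (Fin 1) w ∧
      Y = Matrix.replicateRow (Fin 1) y := by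
  rw [qrr, exec_bind] at hqrr
  obtain ⟨⟨ρ, w, y⟩, s, _, hhouse, ⟨hout, rfl⟩, rfl⟩ := hqrr
  simp only [Prod.mk.injEq] at hout
  exact ⟨ρ, w, y, hhouse, hout⟩

theorem exec_qrr_of_two_le (hm : 2 ≤ m) (hl : l = m / 2) (hlm : l ≤ m) (hmn : m ≤ n)
    {A : Matrix (Fin n) (Fin m) ℝ} {R : Matrix (Fin m) (Fin m) ℝ} {W : Matrix (Fin n) (Fin m) ℝ}
    {Y : Matrix (Fin m) (Fin n) ℝ} {t : ℕ} (hqrr : (qrr mm n m hmn A).Exec ε (R, W, Y) t) :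
    ∃ RL WL YL AR RR WR YR XB tL tAR tR tX,
      (qrr mm n l (hlm.trans hmn) (leftCols hlm A)).Exec ε (RL, WL, YL) tL ∧
      (wyApply mm WL YL (rightCols hlm A)).Exec ε AR tAR ∧
      (qrr mm (n - l) (m - l) (Nat.sub_le_sub_right hmn l)
        (bottomRows (hlm.trans hmn) AR)).Exec ε (RR, WR, YR) tR ∧
      (wyApply mm WR YR (bottomRows (hlm.trans hmn) WL)).Exec ε XB tX ∧
      R = vcat (hcat RL (topRows (hlm.trans hmn) AR)) (hcat 0 RR) ∧
      W = hcat (vcat (topRows (hlm.trans hmn) WL) XB) (vcat 0 WR) ∧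
      Y = vcat YL (hcat 0 YR) ∧
      t = tL + tAR + tR + tX := by
  obtain ⟨m, rfl⟩ := Nat.exists_eq_add_of_le' hm
  subst hl
  rw [qrr] at hqrr
  simp only [exec_bind, exec_pure, exec_literal] at hqrr
  obtain ⟨_, _, _, ⟨rfl, rfl⟩, ⟨⟨RL, WL, YL⟩, tL, _, hL, ⟨YA, t₁, _, h₁, ⟨WYA, t₂, _, h₂,
    ⟨AR, t₃, _, h₃, ⟨⟨RR, WR, YR⟩, tR, _, hR, ⟨YW, t₄, _, h₄, ⟨WYW, t₅, _, h₅, ⟨XB, t₆, _, h₆,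
    ⟨hout, hu⟩, rfl⟩, rfl⟩, rfl⟩, rfl⟩, rfl⟩, rfl⟩, rfl⟩, rfl⟩, rfl⟩ := hqrr
  simp only [Prod.mk.injEq] at hout
  obtain ⟨rfl, rfl, rfl⟩ := hout
  refine ⟨RL, WL, YL, AR, RR, WR, YR, XB, tL, t₁ + (t₂ + t₃), tR, t₄ + (t₅ + t₆), hL, ?_, hR, ?_,
    rfl, rfl, rfl, by omega⟩
  · exact exec_bind.2 ⟨_, _, _, h₁, exec_bind.2 ⟨_, _, _, h₂, h₃, rfl⟩, rfl⟩
  · exact exec_bind.2 ⟨_, _, _, h₄, exec_bind.2 ⟨_, _, _, h₅, h₆, rfl⟩, rfl⟩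

theorem norm_wyApply_sub_le {κ w : ℝ} {r : ℕ} (hn : n ≤ N) (hm : m ≤ N) (hr : r ≤ N)
    (hε : 0 ≤ ε) (hκ : 0 ≤ κ) (hκ1 : κ ≤ 1) (hmm : mm.IsRectAccurate N ε κ)
    {W : Matrix (Fin n) (Fin m) ℝ} {Y : Matrix (Fin m) (Fin n) ℝ} {B Z : Matrix (Fin n) (Fin r) ℝ}
    {t : ℕ} (hW : ‖W‖ ≤ w) (hY : ‖Y‖ ≤ w) (h : (wyApply mm W Y B).Exec ε Z t) :
    ‖Z - (1 - W * Y) * B‖ ≤ (3 * w ^ 2 * κ + N * ε * (1 + 4 * w ^ 2)) * ‖B‖ := by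
  simp only [wyApply, exec_bind] at h
  rw [Matrix.sub_mul, Matrix.one_mul, Matrix.mul_assoc]
  obtain ⟨YB, _, _, hYB, ⟨WYB, _, _, hWYB, hZ, rfl⟩, rfl⟩ := h
  have hw : 0 ≤ w := (norm_nonneg W).trans hW
  have hYB_norm : ‖Y * B‖ ≤ w * ‖B‖ := l2_opNorm_mul_le_of_le hY le_rfl
  have hYB_err : ‖YB - Y * B‖ ≤ κ * (w * ‖B‖) :=
    (hmm _ _ _ hm hn hr _ _ _ _ hYB).trans (by gcongr)
  have hYB_comp : ‖YB‖ ≤ 2 * w * ‖B‖ := by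
    calc ‖YB‖ ≤ ‖Y * B‖ + ‖YB - Y * B‖ := norm_le_norm_add_norm_sub' _ _
      _ ≤ w * ‖B‖ + 1 * (w * ‖B‖) := add_le_add hYB_norm (hYB_err.trans (by gcongr))
      _ = 2 * w * ‖B‖ := by ring
  have hWYB_err : ‖WYB - W * (Y * B)‖ ≤ 3 * w ^ 2 * κ * ‖B‖ := by
    calc ‖WYB - W * (Y * B)‖ = ‖(WYB - W * YB) + W * (YB - Y * B)‖ := by
          rw [Matrix.mul_sub, sub_add_sub_cancel]
      _ ≤ κ * (w * (2 * w * ‖B‖)) + w * (κ * (w * ‖B‖)) :=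
          norm_add_le_of_le ((hmm _ _ _ hn hm hr _ _ _ _ hWYB).trans (by gcongr))
            (l2_opNorm_mul_le_of_le hW hYB_err)
      _ = 3 * w ^ 2 * κ * ‖B‖ := by ring
  have hexact : ‖B - W * (Y * B)‖ ≤ (1 + w ^ 2) * ‖B‖ :=
    (norm_sub_le_of_le le_rfl (l2_opNorm_mul_le_of_le hW hYB_norm)).trans_eq (by ring)
  have hsub : ‖B - WYB - (B - W * (Y * B))‖ ≤ 3 * w ^ 2 * κ * ‖B‖ := by
    rwa [sub_sub_sub_cancel_left, norm_sub_rev]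
  calc ‖Z - (B - W * (Y * B))‖
      ≤ 3 * w ^ 2 * κ * ‖B‖ + N * ε * ((1 + w ^ 2) * ‖B‖ + 3 * w ^ 2 * κ * ‖B‖) :=
        norm_matSub_sub_le hε hn hr hexact hsub hZ
    _ ≤ 3 * w ^ 2 * κ * ‖B‖ + N * ε * ((1 + w ^ 2) * ‖B‖ + 3 * w ^ 2 * 1 * ‖B‖) := by gcongr
    _ = (3 * w ^ 2 * κ + N * ε * (1 + 4 * w ^ 2)) * ‖B‖ := by ring

end Recursion

/-! ### Householder transformations -/

open WithLp (toLp)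

section InnerProductSpace

variable {E : Type*} [NormedAddCommGroup E] [InnerProductSpace ℝ E] {x y : E}

theorem two_mul_inner_sub_left_self (h : ‖x‖ = ‖y‖) : 2 * inner ℝ (x - y) x = ‖x - y‖ ^ 2 := by
  rw [norm_sub_sq_real, ← h, inner_sub_left, real_inner_self_eq_norm_sq, real_inner_comm]
  ring

theorem norm_le_norm_sub_of_inner_nonpos (h : inner ℝ x y ≤ 0) : ‖x‖ ≤ ‖x - y‖ := by
  refine le_of_sq_le_sq ?_ (norm_nonneg _)
  rw [norm_sub_sq_real]
  linarith [sq_nonneg ‖y‖]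

end InnerProductSpace

theorem norm_inv_smul_sub_inv_smul_le {E : Type*} [NormedAddCommGroup E] [NormedSpace ℝ E]
    {v v' : E} {τ a b : ℝ} (hv : v ≠ 0) (ha : ‖v' - v‖ ≤ a * ‖v‖) (hb : |τ - ‖v‖| ≤ b * ‖v‖)
    (hb2 : b ≤ 1 / 2) : ‖τ⁻¹ • v' - ‖v‖⁻¹ • v‖ ≤ 2 * (a + b) := by
  have hT : 0 < ‖v‖ := norm_pos_iff.2 hv
  have hτT : ‖v‖ ≤ 2 * τ := by nlinarith [neg_abs_le (τ - ‖v‖)]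
  have hτ : 0 < τ := by linarith
  have hsplit : τ⁻¹ • v' - ‖v‖⁻¹ • v = τ⁻¹ • ((v' - v) - ((τ - ‖v‖) * ‖v‖⁻¹) • v) := by
    rw [sub_mul, mul_inv_cancel₀ hT.ne', sub_smul, one_smul, sub_sub_sub_cancel_right, smul_sub,
      smul_smul, inv_mul_cancel_left₀ hτ.ne']
  have hlength : ‖((τ - ‖v‖) * ‖v‖⁻¹) • v‖ ≤ b * ‖v‖ := by
    rw [norm_smul, norm_mul, norm_inv, norm_norm, inv_mul_cancel_right₀ hT.ne']
    exact hb
  rw [hsplit, norm_smul, norm_inv, Real.norm_of_nonneg hτ.le, inv_mul_le_iff₀ hτ]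
  have hab : 0 ≤ a + b :=
    nonneg_of_mul_nonneg_left (by linarith [norm_nonneg (v' - v), abs_nonneg (τ - ‖v‖)]) hT
  calc ‖(v' - v) - ((τ - ‖v‖) * ‖v‖⁻¹) • v‖ ≤ a * ‖v‖ + b * ‖v‖ := norm_sub_le_of_le ha hlength
    _ = (a + b) * ‖v‖ := by ring
    _ ≤ (a + b) * (2 * τ) := by gcongr
    _ = τ * (2 * (a + b)) := by ring

theorem norm_toLp_sub_le_mul {ι : Type*} [Fintype ι] {x y : ι → ℝ} {ε : ℝ} (hε : 0 ≤ ε)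
    (h : ∀ i, |y i - x i| ≤ ε * |x i|) : ‖toLp 2 y - toLp 2 x‖ ≤ ε * ‖toLp 2 x‖ := by
  rw [← abs_of_nonneg hε, ← Real.norm_eq_abs, ← norm_smul, EuclideanSpace.norm_eq,
    EuclideanSpace.norm_eq]
  gcongr with i
  simpa [abs_mul, abs_of_nonneg hε] using h i

section Reflection

variable {ι R : Type*} [Fintype ι] [DecidableEq ι] [CommRing R]

theorem one_sub_vecMulVec_two_smul_mem_orthogonalGroup {u : ι → R} (hu : u ⬝ᵥ u = 1) :
    1 - Matrix.vecMulVec u ((2 : R) • u) ∈ Matrix.orthogonalGroup ι R := by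
  rw [Matrix.mem_orthogonalGroup_iff]
  simp only [Matrix.transpose_sub, Matrix.transpose_one, Matrix.vecMulVec_smul,
    Matrix.transpose_smul, Matrix.transpose_vecMulVec, sub_mul, mul_sub,
    Matrix.vecMulVec_mul_vecMulVec, Matrix.smul_mul, Matrix.mul_smul, one_mul, mul_one, hu,
    one_smul]
  module

end Reflection

theorem one_sub_vecMulVec_mulVec_eq {n : ℕ} {x y : EuclideanSpace ℝ (Fin n)} (h : ‖x‖ = ‖y‖)
    (hxy : x ≠ y) :
    (1 - Matrix.vecMulVec (‖x - y‖⁻¹ • (x - y)).ofLp ((2 : ℝ) • (‖x - y‖⁻¹ • (x - y)).ofLp)).mulVec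
      x.ofLp = y.ofLp := by
  have hT : ‖x - y‖ ≠ 0 := norm_ne_zero_iff.2 (sub_ne_zero.2 hxy)
  have hinner : ((2 : ℝ) • (‖x - y‖⁻¹ • (x - y)).ofLp) ⬝ᵥ x.ofLp = ‖x - y‖ := by
    have := two_mul_inner_sub_left_self h
    rw [EuclideanSpace.inner_eq_star_dotProduct, star_trivial, dotProduct_comm] at this
    rw [WithLp.ofLp_smul, smul_smul, smul_dotProduct, smul_eq_mul]
    field_simp
    linarith
  rw [Matrix.sub_mulVec, Matrix.one_mulVec, Matrix.vecMulVec_mulVec, hinner, op_smul_eq_smul,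
    WithLp.ofLp_smul, smul_inv_smul₀ hT, WithLp.ofLp_sub, sub_sub_cancel]

section VecLength

variable {n : ℕ} {ε : ℝ}

/-- The loop of `vecLength` that computes the sum of the squares of the components of `x`. -/
def sumSq {V : Type} (zero : V) (x : Fin n → V) : Prog V V :=
  (List.finRange n).foldlM (init := zero) fun acc i => do
    let p ← fmul (x i) (x i)
    fadd acc p

theorem exec_sumSq {x : Fin n → ℝ} {s : ℝ} {t : ℕ} (hε : 0 ≤ ε) (h : (sumSq 0 x).Exec ε s t) :
    |s - ∑ i, x i ^ 2| ≤ ((1 + ε) ^ (n + 1) - 1) * ∑ i, x i ^ 2 ∧ t = 2 * n := by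
  have hloop := Exec.foldlM (fun l s t =>
    0 ≤ (l.map fun i => x i ^ 2).sum ∧
    |s - (l.map fun i => x i ^ 2).sum| ≤
      ((1 + ε) ^ (l.length + 1) - 1) * (l.map fun i => x i ^ 2).sum ∧
    t = 2 * l.length) ?_ (by simp) h
  · simpa [List.sum_ofFn, ← List.ofFn_eq_map] using hloop.2
  rintro l i s s' _ _ ⟨hS, hs, rfl⟩ hs'
  simp only [exec_bind, exec_fmul, exec_fadd] at hs'
  obtain ⟨p, _, _, ⟨hp, rfl⟩, ⟨hs', rfl⟩, rfl⟩ := hs'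
  simp only [List.map_append, List.sum_append, List.map_singleton, List.sum_singleton,
    List.length_append, List.length_singleton]
  set S := (l.map fun i => x i ^ 2).sum
  set c := (1 + ε) ^ (l.length + 1) with hc
  have hcε : 1 + ε ≤ c := le_self_pow₀ (by linarith) (by omega)
  have hSx : 0 ≤ S + x i ^ 2 := by positivity
  have hp' : |p - x i ^ 2| ≤ (c - 1) * x i ^ 2 := by
    rw [← sq, abs_of_nonneg (sq_nonneg (x i))] at hp
    exact hp.trans (by gcongr; linarith)
  have hsp : |s + p - (S + x i ^ 2)| ≤ (c - 1) * (S + x i ^ 2) := by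
    rw [add_sub_add_comm, mul_add]
    exact (abs_add_le _ _).trans (add_le_add hs hp')
  refine ⟨hSx, ?_, by ring⟩
  calc |s' - (S + x i ^ 2)|
      ≤ (c - 1) * (S + x i ^ 2) + ε * ((S + x i ^ 2) + (c - 1) * (S + x i ^ 2)) :=
        norm_sub_le_of_norm_sub_le_mul (E := ℝ) hε (abs_of_nonneg hSx).le hsp
          (hs'.trans_eq (by simp))
    _ = ((1 + ε) ^ (l.length + 1 + 1) - 1) * (S + x i ^ 2) := by
        rw [pow_succ _ (l.length + 1), ← hc]
        ring

theorem exec_vecLength {x : Fin n → ℝ} {σ : ℝ} {t : ℕ} (hε : 0 ≤ ε)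
    (h : (vecLength x).Exec ε σ t) :
    |σ - ‖toLp 2 x‖| ≤ ((1 + ε) ^ (n + 2) - 1) * ‖toLp 2 x‖ ∧ t = 2 * n + 1 := by
  simp only [vecLength, exec_bind, exec_literal, exec_fsqrt] at h
  obtain ⟨_, _, _, ⟨rfl, rfl⟩, ⟨s, _, _, hs, ⟨hσ, rfl⟩, rfl⟩, rfl⟩ := h
  obtain ⟨hsum, rfl⟩ := exec_sumSq hε hs
  have hnorm : ‖toLp 2 x‖ = √(∑ i, x i ^ 2) := by
    simp [EuclideanSpace.norm_eq]
  rw [hnorm]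
  set r := √(∑ i, x i ^ 2)
  have hr : 0 ≤ r := Real.sqrt_nonneg _
  refine ⟨?_, by ring⟩
  calc |σ - r| ≤ ((1 + ε) ^ (n + 1) - 1) * r + ε * (r + ((1 + ε) ^ (n + 1) - 1) * r) :=
        norm_sub_le_of_norm_sub_le_mul (E := ℝ) hε (abs_of_nonneg hr).le
          (abs_sqrt_sub_sqrt_le (Finset.sum_nonneg fun _ _ => sq_nonneg _) hsum)
          (hσ.trans_eq (by rw [Real.norm_of_nonneg (Real.sqrt_nonneg s)]))
    _ = ((1 + ε) ^ (n + 2) - 1) * r := by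
        rw [pow_succ _ (n + 1)]
        ring

theorem abs_sub_le_of_exec_vecLength {x : Fin n → ℝ} {σ η : ℝ} {t : ℕ} (hε : 0 ≤ ε)
    (hη : (2 * n + 4) * ε ≤ η) (hη1 : η ≤ 1) (h : (vecLength x).Exec ε σ t) :
    |σ - ‖toLp 2 x‖| ≤ η * ‖toLp 2 x‖ := by
  have hn : 2 * ((n + 2 : ℕ) : ℝ) * ε = (2 * n + 4) * ε := by
    push_cast
    ring
  have hpow := one_add_pow_le_one_add_two_mul hε (hn.trans_le (hη.trans hη1))
  refine (exec_vecLength hε h).1.trans ?_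
  gcongr
  linarith

/-- The part of `householder` after the choice of `ρ`: it forms the Householder vector for the
target `ρ e` and normalises it, where `e` is the unit vector of index `first`. -/
def householderVector {V : Type} (two : V) (first : Fin n) (x : Fin n → V) (ρ : V) :
    Prog V (V × (Fin n → V) × (Fin n → V)) := do
  let v₁ ← fsub (x first) ρ
  let v : Fin n → V := fun i => if i = first then v₁ else x i
  let τ ← vecLength v
  let w ← tabulate fun i => fdiv (v i) τ
  let y ← tabulate fun i => fmul two (w i)
  pure (ρ, w, y)

theorem exec_householderVector {first : Fin n} {x w y : Fin n → ℝ} {ρ₀ ρ : ℝ} {t : ℕ}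
    (h : (householderVector 2 first x ρ₀).Exec ε (ρ, w, y) t) :
    ρ = ρ₀ ∧ ∃ v₁ τ tτ, |v₁ - (x first - ρ)| ≤ ε * |x first - ρ| ∧
      (vecLength (Function.update x first v₁)).Exec ε τ tτ ∧
      (∀ i, |w i - Function.update x first v₁ i / τ| ≤
        ε * |Function.update x first v₁ i / τ|) ∧
      (∀ i, |y i - 2 * w i| ≤ ε * |2 * w i|) ∧ t = tτ + 2 * n + 1 := by
  have hupdate (v₁ : ℝ) : (fun i => if i = first then v₁ else x i) = Function.update x first v₁ :=
    funext fun i => by rw [Function.update_apply]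
  simp only [householderVector, exec_bind, exec_fsub, exec_pure, hupdate] at h
  obtain ⟨v₁, _, _, ⟨hv₁, rfl⟩, ⟨τ, tτ, _, hτ, ⟨_, _, _, hw, ⟨_, _, _, hy, ⟨hout, rfl⟩, rfl⟩, rfl⟩,
    rfl⟩, rfl⟩ := h
  simp only [Prod.mk.injEq] at hout
  obtain ⟨rfl, rfl, rfl⟩ := hout
  obtain ⟨tw, hquot, rfl⟩ := hw.tabulate
  obtain ⟨ty, hprod, rfl⟩ := hy.tabulate
  simp only [← Function.update_apply, exec_fdiv] at hquot
  simp only [exec_fmul] at hprod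
  refine ⟨rfl, v₁, τ, tτ, hv₁, hτ, fun i => (hquot i).1, fun i => (hprod i).1, ?_⟩
  obtain rfl : tw = fun _ => 1 := funext fun i => (hquot i).2
  obtain rfl : ty = fun _ => 1 := funext fun i => (hprod i).2
  simp only [Finset.sum_const, Finset.card_univ, Fintype.card_fin, smul_eq_mul]
  ring

theorem exec_householder {hn : 0 < n} {x w y : Fin n → ℝ} {ρ : ℝ} {t : ℕ}
    (h : (householder hn x).Exec ε (ρ, w, y) t) :
    ∃ σ tσ, (vecLength x).Exec ε σ tσ ∧
      (σ ≤ 0 ∧ ρ = 0 ∧ w = Pi.single ⟨0, hn⟩ 1 ∧ y = Pi.single ⟨0, hn⟩ 2 ∧ t = tσ + 1 ∨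
      0 < σ ∧ (x ⟨0, hn⟩ < 0 → ρ = σ) ∧ (0 ≤ x ⟨0, hn⟩ → |ρ + σ| ≤ ε * σ) ∧
        ∃ tv, (householderVector 2 ⟨0, hn⟩ x ρ).Exec ε (ρ, w, y) tv ∧ t ≤ tσ + tv + 3) := by
  simp only [householder, exec_bind, exec_literal, exec_isLess] at h
  obtain ⟨_, _, _, ⟨rfl, rfl⟩, ⟨_, _, _, ⟨rfl, rfl⟩, ⟨_, _, _, ⟨rfl, rfl⟩, ⟨σ, tσ, _, hσ,
    ⟨_, _, _, ⟨rfl, rfl⟩, h, rfl⟩, rfl⟩, rfl⟩, rfl⟩, rfl⟩ := h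
  refine ⟨σ, tσ, hσ, ?_⟩
  rcases lt_or_ge 0 σ with hpos | hneg
  · simp only [hpos, decide_true, if_true, exec_bind, exec_isLess] at h
    obtain ⟨_, _, _, ⟨rfl, rfl⟩, h, rfl⟩ := h
    rcases lt_or_ge (x ⟨0, hn⟩) 0 with hx | hx
    · simp only [hx, decide_true, if_true] at h
      rw [exec_bind] at h
      obtain ⟨_, _, tv, ⟨rfl, rfl⟩, hv, rfl⟩ := h
      obtain rfl := (exec_householderVector hv).1
      exact Or.inr ⟨hpos, fun _ => rfl, fun hx' => absurd hx hx'.not_gt, tv, hv, by omega⟩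
    · simp only [hx.not_gt, decide_false, Bool.false_eq_true, if_false] at h
      rw [exec_bind] at h
      obtain ⟨_, _, tv, hρ, hv, rfl⟩ := h
      obtain rfl := (exec_householderVector hv).1
      obtain ⟨hρσ, rfl⟩ := exec_fsub.1 hρ
      rw [zero_sub, sub_neg_eq_add, abs_neg, abs_of_pos hpos] at hρσ
      exact Or.inr ⟨hpos, fun hx' => absurd hx' hx.not_gt, fun _ => hρσ, tv, hv, by omega⟩
  · simp only [hneg.not_gt, decide_false, Bool.false_eq_true, if_false, exec_pure,
      Prod.mk.injEq] at h
    obtain ⟨⟨rfl, rfl, rfl⟩, rfl⟩ := h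
    exact Or.inl ⟨hneg, rfl, by ext; simp [Pi.single_apply], by ext; simp [Pi.single_apply],
      by omega⟩

theorem exec_householder_cost {hn : 0 < n} {x : Fin n → ℝ} {o : ℝ × (Fin n → ℝ) × (Fin n → ℝ)}
    {t : ℕ} (hε : 0 ≤ ε) (h : (householder hn x).Exec ε o t) : t ≤ 12 * n := by
  obtain ⟨σ, tσ, hσ, ⟨-, -, -, -, rfl⟩ | ⟨-, -, -, tv, hv, ht⟩⟩ := exec_householder h
  · rw [(exec_vecLength hε hσ).2]
    omega
  · obtain ⟨-, _, _, _, -, hτ, -, -, rfl⟩ := exec_householderVector hv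
    rw [(exec_vecLength hε hσ).2, (exec_vecLength hε hτ).2] at ht
    omega

theorem norm_householderVector_sub_le {first : Fin n} {x w y : Fin n → ℝ}
    {v : EuclideanSpace ℝ (Fin n)} {ρ₀ ρ g η : ℝ} {t : ℕ} (hε : 0 ≤ ε)
    (hη : (2 * n + 4) * ε ≤ η) (hη1 : 100 * η ≤ 1)
    (hv : v = toLp 2 x - EuclideanSpace.single first g) (hv0 : v ≠ 0)
    (hρ : |ρ₀ - g| ≤ 2 * η * ‖v‖)
    (h : (householderVector 2 first x ρ₀).Exec ε (ρ, w, y) t) :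
    ‖toLp 2 w - ‖v‖⁻¹ • v‖ ≤ 17 * η ∧ ‖toLp 2 y - (2 : ℝ) • ‖v‖⁻¹ • v‖ ≤ 35 * η := by
  obtain ⟨rfl, v₁, τ, tτ, hv₁, hτ, hw, hy, -⟩ := exec_householderVector h
  have hεη : 4 * ε ≤ η := by nlinarith [n.cast_nonneg (α := ℝ)]
  have hη0 : 0 ≤ η := by linarith
  have hT : 0 ≤ ‖v‖ := norm_nonneg v
  set vc := toLp 2 (Function.update x first v₁) with hvc
  have hfirst : |x first - g| ≤ ‖v‖ := by
    simpa [hv] using PiLp.norm_apply_le v first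
  have hv₁g : |v₁ - (x first - g)| ≤ 3 * η * ‖v‖ := by
    have hsub : |x first - ρ - (x first - g)| ≤ 2 * η * ‖v‖ := by
      rwa [sub_sub_sub_cancel_left, abs_sub_comm]
    refine (norm_sub_le_of_norm_sub_le_mul (E := ℝ) hε hfirst hsub
      (hv₁.trans_eq (by simp))).trans ?_
    nlinarith [mul_le_mul_of_nonneg_right hεη hT, mul_nonneg hη0 hT]
  have hvcv : ‖vc - v‖ ≤ 3 * η * ‖v‖ := by
    have hsingle : vc - v = EuclideanSpace.single first (v₁ - (x first - g)) := by
      ext i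
      rcases eq_or_ne i first with rfl | hi
      · simp [hv, hvc]
      · simp [hv, hvc, hi]
    rwa [hsingle, PiLp.norm_single]
  have hτv : |τ - ‖v‖| ≤ 5 * η * ‖v‖ := by
    refine (norm_sub_le_of_norm_sub_le_mul (E := ℝ) hη0 (norm_norm v).le
      ((abs_norm_sub_norm_le vc v).trans hvcv) ?_).trans ?_
    · simpa using abs_sub_le_of_exec_vecLength hε hη (by linarith) hτ
    · nlinarith [mul_nonneg hη0 hT]
  have hu : ‖‖v‖⁻¹ • v‖ = 1 := norm_smul_inv_norm (𝕜 := ℝ) hv0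
  have hw' : ‖toLp 2 w - ‖v‖⁻¹ • v‖ ≤ 17 * η := by
    refine (norm_sub_le_of_norm_sub_le_mul hε hu.le
      (norm_inv_smul_sub_inv_smul_le hv0 hvcv hτv (by linarith)) ?_).trans ?_
    · refine norm_toLp_sub_le_mul hε fun i => ?_
      simpa [div_eq_inv_mul] using hw i
    · nlinarith
  refine ⟨hw', ?_⟩
  have hdouble {z : EuclideanSpace ℝ (Fin n)} : ‖(2 : ℝ) • z‖ = 2 * ‖z‖ := by simp [norm_smul]
  refine (norm_sub_le_of_norm_sub_le_mul hε (b := 2) (e := 34 * η) (y := (2 : ℝ) • toLp 2 w)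
    (by rw [hdouble, hu]; norm_num) ?_ (norm_toLp_sub_le_mul hε hy)).trans (by nlinarith)
  rw [← smul_sub, hdouble]
  linarith

theorem exists_abs_eq_and_mul_nonpos {x₁ ρ σ s η : ℝ} (hε : 0 ≤ ε) (hεη : 2 * ε ≤ η) (hη : η ≤ 1)
    (hs : 0 ≤ s) (hσ : |σ - s| ≤ η * s) (hneg : x₁ < 0 → ρ = σ)
    (hnonneg : 0 ≤ x₁ → |ρ + σ| ≤ ε * σ) :
    ∃ g, |g| = s ∧ |ρ - g| ≤ 2 * η * s ∧ x₁ * g ≤ 0 := by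
  have hηs : 0 ≤ η * s := mul_nonneg (by linarith) hs
  rcases lt_or_ge x₁ 0 with hx | hx
  · refine ⟨s, abs_of_nonneg hs, ?_, mul_nonpos_of_nonpos_of_nonneg hx.le hs⟩
    rw [hneg hx]
    linarith
  · refine ⟨-s, by rw [abs_neg, abs_of_nonneg hs], ?_,
      mul_nonpos_of_nonneg_of_nonpos hx (neg_nonpos.2 hs)⟩
    have hεσ : ε * σ ≤ η * s := by
      have hσ2 : σ ≤ 2 * s := by nlinarith [le_abs_self (σ - s)]
      nlinarith [mul_le_mul_of_nonneg_left hσ2 hε]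
    calc |ρ - -s| = |(ρ + σ) - (σ - s)| := by ring_nf
      _ ≤ ε * σ + η * s := (abs_sub _ _).trans (add_le_add (hnonneg hx) hσ)
      _ ≤ 2 * η * s := by linarith

theorem exists_reflection_near_householder {hn : 0 < n} {x w y : Fin n → ℝ} {ρ η : ℝ} {t : ℕ}
    (hε : 0 ≤ ε) (hη : (2 * n + 4) * ε ≤ η) (hη1 : 100 * η ≤ 1)
    (h : (householder hn x).Exec ε (ρ, w, y) t) :
    ∃ (u : EuclideanSpace ℝ (Fin n)) (g : ℝ), ‖u‖ = 1 ∧ ‖toLp 2 w - u‖ ≤ 17 * η ∧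
      ‖toLp 2 y - (2 : ℝ) • u‖ ≤ 35 * η ∧ |ρ - g| ≤ 2 * η * ‖toLp 2 x‖ ∧
      (1 - Matrix.vecMulVec u.ofLp ((2 : ℝ) • u.ofLp)).mulVec x = Pi.single ⟨0, hn⟩ g := by
  obtain ⟨σ, tσ, hσ, hcases⟩ := exec_householder h
  have hη0 : 0 ≤ η := le_trans (by positivity) hη
  have hεη : 4 * ε ≤ η := by nlinarith [n.cast_nonneg (α := ℝ)]
  have hσs := abs_sub_le_of_exec_vecLength hε hη (by linarith) hσ
  set s := ‖toLp 2 x‖ with hs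
  have hs0 : 0 ≤ s := norm_nonneg _
  rcases hcases with ⟨hσ0, rfl, rfl, rfl, -⟩ | ⟨hpos, hρneg, hρnonneg, tv, hv, -⟩
  · have hx : x = 0 := by
      have : s = 0 := by nlinarith [neg_abs_le (σ - s)]
      simpa [hs] using this
    refine ⟨EuclideanSpace.single ⟨0, hn⟩ 1, 0, by simp, ?_, ?_, ?_, by simp [hx]⟩
    · rw [PiLp.toLp_single, sub_self, norm_zero]
      positivity
    · have hsingle : toLp 2 (Pi.single ⟨0, hn⟩ 2) =
          (2 : ℝ) • EuclideanSpace.single (⟨0, hn⟩ : Fin n) (1 : ℝ) := by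
        ext i
        simp [Pi.single_apply]
      rw [hsingle, sub_self, norm_zero]
      positivity
    · rw [sub_self, abs_zero]
      positivity
  · obtain ⟨g, hgs, hρg, hxg⟩ := exists_abs_eq_and_mul_nonpos hε (by linarith) (by linarith) hs0 hσs
      hρneg hρnonneg
    set y₀ := EuclideanSpace.single (⟨0, hn⟩ : Fin n) g
    have hspos : 0 < s := by
      nlinarith [le_abs_self (σ - s)]
    have hT : s ≤ ‖toLp 2 x - y₀‖ := norm_le_norm_sub_of_inner_nonpos (by
      simpa [y₀, EuclideanSpace.inner_single_right, mul_comm] using hxg)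
    have hv0 : toLp 2 x - y₀ ≠ 0 := norm_pos_iff.1 (hspos.trans_le hT)
    obtain ⟨hw, hy⟩ := norm_householderVector_sub_le hε hη hη1 rfl hv0
      (hρg.trans (by gcongr)) hv
    exact ⟨_, g, norm_smul_inv_norm (𝕜 := ℝ) hv0, hw, hy, hρg,
      one_sub_vecMulVec_mulVec_eq (by simp [y₀, hgs, s]) (sub_ne_zero.1 hv0)⟩

end VecLength

/-! ### Approximate QR decompositions -/

section Triangularization

variable {n m l : ℕ}

/-- `P` agrees up to an error `q` with an orthogonal matrix that brings `A` to the form `[R; 0]` up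
to an error `a * ‖A‖`. Measuring the error on the side of `[R; 0]` makes errors of successive
transformations add up; `IsApproxTriangularization.exists_perturbation` moves it to `A`. -/
def IsApproxTriangularization (A : Matrix (Fin n) (Fin m) ℝ) (R : Matrix (Fin m) (Fin m) ℝ)
    (P : Matrix (Fin n) (Fin n) ℝ) (q a : ℝ) : Prop :=
  ∃ Q ∈ Matrix.orthogonalGroup (Fin n) ℝ, ‖Q - P‖ ≤ q ∧ ‖Q * A - vcat R 0‖ ≤ a * ‖A‖

theorem IsApproxTriangularization.mono {A : Matrix (Fin n) (Fin m) ℝ}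
    {R : Matrix (Fin m) (Fin m) ℝ} {P : Matrix (Fin n) (Fin n) ℝ} {q q' a a' : ℝ}
    (h : IsApproxTriangularization A R P q a) (hq : q ≤ q') (ha : a ≤ a') :
    IsApproxTriangularization A R P q' a' := by
  obtain ⟨Q, hQ, hQP, hQA⟩ := h
  exact ⟨Q, hQ, hQP.trans hq, hQA.trans (by gcongr)⟩

theorem IsApproxTriangularization.exists_perturbation {A : Matrix (Fin n) (Fin m) ℝ}
    {R : Matrix (Fin m) (Fin m) ℝ} {P : Matrix (Fin n) (Fin n) ℝ} {q a : ℝ}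
    (h : IsApproxTriangularization A R P q a) :
    ∃ (δQ : Matrix (Fin n) (Fin n) ℝ) (δA : Matrix (Fin n) (Fin m) ℝ),
      P + δQ ∈ Matrix.orthogonalGroup (Fin n) ℝ ∧ (P + δQ) * (A + δA) = vcat R 0 ∧
      ‖δQ‖ ≤ q ∧ ‖δA‖ ≤ a * ‖A‖ := by
  obtain ⟨Q, hQ, hQP, hQA⟩ := h
  have hQ' : Q.transpose ∈ Matrix.orthogonalGroup (Fin n) ℝ := Unitary.star_mem hQ
  have hQQ : Q * Q.transpose = 1 := Matrix.mem_orthogonalGroup_iff _ _ |>.1 hQ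
  refine ⟨Q - P, Q.transpose * (vcat R 0 - Q * A), ?_, ?_, hQP, ?_⟩
  · rwa [add_sub_cancel]
  · rw [add_sub_cancel, Matrix.mul_add, ← Matrix.mul_assoc, hQQ, Matrix.one_mul,
      add_sub_cancel]
  · rw [norm_sub_rev] at hQA
    simpa using l2_opNorm_mul_le_of_le (l2_opNorm_le_one_of_mem_orthogonalGroup hQ') hQA

theorem norm_sub_mul_le_of_norm_sub_le {k : ℕ} {P Q : Matrix (Fin n) (Fin n) ℝ}
    {B Z : Matrix (Fin n) (Fin k) ℝ} {e q : ℝ} (hQP : ‖Q - P‖ ≤ q) (hZ : ‖Z - P * B‖ ≤ e * ‖B‖) :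
    ‖Z - Q * B‖ ≤ (e + q) * ‖B‖ := by
  have hsplit : Z - Q * B = (Z - P * B) - (Q - P) * B := by
    rw [Matrix.sub_mul, sub_sub_sub_cancel_right]
  rw [hsplit, add_mul]
  exact norm_sub_le_of_le hZ (l2_opNorm_mul_le_of_le hQP le_rfl)

section DiagOne

variable (h : l ≤ n) {Q₁ P₁ P : Matrix (Fin n) (Fin n) ℝ}
  {Q₂ P₂ : Matrix (Fin (n - l)) (Fin (n - l)) ℝ} {q₁ q₂ : ℝ}

theorem norm_diagOne_mul_le {k : ℕ} (hQ₂ : Q₂ ∈ Matrix.orthogonalGroup (Fin (n - l)) ℝ)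
    (B : Matrix (Fin n) (Fin k) ℝ) : ‖diagOne h Q₂ * B‖ ≤ ‖B‖ := by
  simpa using l2_opNorm_mul_le_of_le
    (l2_opNorm_le_one_of_mem_orthogonalGroup (diagOne_mem_orthogonalGroup h hQ₂)) le_rfl (B := B)

theorem norm_diagOne_le_of_norm_sub_le (hQ₂ : Q₂ ∈ Matrix.orthogonalGroup (Fin (n - l)) ℝ)
    (hQP₂ : ‖Q₂ - P₂‖ ≤ q₂) : ‖diagOne h P₂‖ ≤ 1 + q₂ :=
  (norm_le_norm_add_norm_sub (diagOne h Q₂) _).trans (add_le_add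
    (l2_opNorm_le_one_of_mem_orthogonalGroup (diagOne_mem_orthogonalGroup h hQ₂))
    ((norm_diagOne_sub_diagOne_le h Q₂ P₂).trans hQP₂))

theorem norm_diagOne_mul_sub_le (hQ₁ : Q₁ ∈ Matrix.orthogonalGroup (Fin n) ℝ)
    (hQ₂ : Q₂ ∈ Matrix.orthogonalGroup (Fin (n - l)) ℝ) (hQP₁ : ‖Q₁ - P₁‖ ≤ q₁)
    (hQP₂ : ‖Q₂ - P₂‖ ≤ q₂) :
    ‖diagOne h Q₂ * Q₁ - P‖ ≤ q₁ + q₂ * (1 + q₁) + ‖P - diagOne h P₂ * P₁‖ := by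
  have hP₁ : ‖P₁‖ ≤ 1 + q₁ := (norm_le_norm_add_norm_sub Q₁ _).trans
    (add_le_add (l2_opNorm_le_one_of_mem_orthogonalGroup hQ₁) hQP₁)
  have hsplit : diagOne h Q₂ * Q₁ - P = diagOne h Q₂ * (Q₁ - P₁) +
      (diagOne h Q₂ - diagOne h P₂) * P₁ - (P - diagOne h P₂ * P₁) := by
    rw [Matrix.mul_sub, Matrix.sub_mul]
    abel
  rw [hsplit]
  exact norm_sub_le_of_le (norm_add_le_of_le ((norm_diagOne_mul_le h hQ₂ _).trans hQP₁)
    (l2_opNorm_mul_le_of_le ((norm_diagOne_sub_diagOne_le h Q₂ P₂).trans hQP₂) hP₁)) le_rfl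

theorem norm_diagOne_mul_sub_vcat_zero_le {k : ℕ}
    (hQ₂ : Q₂ ∈ Matrix.orthogonalGroup (Fin (n - l)) ℝ) (B : Matrix (Fin n) (Fin k) ℝ)
    (R : Matrix (Fin l) (Fin k) ℝ) : ‖diagOne h Q₂ * B - vcat R 0‖ ≤ ‖B - vcat R 0‖ := by
  have hsplit : diagOne h Q₂ * B - vcat R 0 = diagOne h Q₂ * (B - vcat R 0) := by
    rw [vcat_zero h, Matrix.mul_sub, ← Matrix.mul_assoc _ _ R, diagOne_mul_topEmb]
  exact hsplit ▸ norm_diagOne_mul_le h hQ₂ _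

theorem norm_diagOne_mul_sub_vcat_topRows_le {k : ℕ}
    (hQ₂ : Q₂ ∈ Matrix.orthogonalGroup (Fin (n - l)) ℝ) (B Z : Matrix (Fin n) (Fin k) ℝ)
    (S : Matrix (Fin (n - l)) (Fin k) ℝ) :
    ‖diagOne h Q₂ * B - vcat (topRows h Z) S‖ ≤ ‖Q₂ * bottomRows h Z - S‖ + ‖Z - B‖ := by
  have hsplit : diagOne h Q₂ * B - vcat (topRows h Z) S =
      botEmb ℝ h * (Q₂ * bottomRows h Z - S) - diagOne h Q₂ * (Z - B) := by
    rw [vcat_eq h, Matrix.mul_sub (diagOne h Q₂), diagOne_mul h Q₂ Z, Matrix.mul_sub]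
    abel
  rw [hsplit]
  exact norm_sub_le_of_le (norm_botEmb_mul_le h _) (norm_diagOne_mul_le h hQ₂ _)

end DiagOne

theorem IsApproxTriangularization.glue (hlm : l ≤ m) (hmn : m ≤ n) {A : Matrix (Fin n) (Fin m) ℝ}
    {AR : Matrix (Fin n) (Fin (m - l)) ℝ} {RL : Matrix (Fin l) (Fin l) ℝ}
    {RR : Matrix (Fin (m - l)) (Fin (m - l)) ℝ} {P P₁ : Matrix (Fin n) (Fin n) ℝ}
    {P₂ : Matrix (Fin (n - l)) (Fin (n - l)) ℝ} {q₁ a₁ q₂ a₂ e f : ℝ}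
    (ha₁ : 0 ≤ a₁) (ha₂ : 0 ≤ a₂) (he : 0 ≤ e)
    (hL : IsApproxTriangularization (leftCols hlm A) RL P₁ q₁ a₁)
    (hAR : ‖AR - P₁ * rightCols hlm A‖ ≤ e * ‖rightCols hlm A‖)
    (hR : IsApproxTriangularization (bottomRows (hlm.trans hmn) AR) RR P₂ q₂ a₂)
    (hP : ‖P - diagOne (hlm.trans hmn) P₂ * P₁‖ ≤ f) :
    IsApproxTriangularization A
      (vcat (hcat RL (topRows (hlm.trans hmn) AR)) (hcat 0 RR)) P
      (q₁ + q₂ * (1 + q₁) + f) (a₁ + (e + q₁) + a₂ * (1 + (e + q₁))) := by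
  obtain ⟨Q₁, hQ₁, hQP₁, hQA₁⟩ := hL
  obtain ⟨Q₂, hQ₂, hQP₂, hQA₂⟩ := hR
  set hln := hlm.trans hmn
  have hright : ‖AR - Q₁ * rightCols hlm A‖ ≤ (e + q₁) * ‖A‖ := by
    have hq₁ : 0 ≤ q₁ := (norm_nonneg _).trans hQP₁
    refine (norm_sub_mul_le_of_norm_sub_le hQP₁ hAR).trans ?_
    gcongr
    exact norm_rightCols_le hlm A
  have hbottom : ‖bottomRows hln AR‖ ≤ (1 + (e + q₁)) * ‖A‖ := by
    calc ‖bottomRows hln AR‖ ≤ ‖Q₁ * rightCols hlm A‖ + ‖AR - Q₁ * rightCols hlm A‖ :=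
          (norm_bottomRows_le hln AR).trans (norm_le_norm_add_norm_sub' _ _)
      _ ≤ 1 * ‖A‖ + (e + q₁) * ‖A‖ := add_le_add (l2_opNorm_mul_le_of_le
          (l2_opNorm_le_one_of_mem_orthogonalGroup hQ₁) (norm_rightCols_le hlm A)) hright
      _ = (1 + (e + q₁)) * ‖A‖ := by ring
  refine ⟨diagOne hln Q₂ * Q₁, mul_mem (diagOne_mem_orthogonalGroup hln hQ₂) hQ₁,
    (norm_diagOne_mul_sub_le hln hQ₁ hQ₂ hQP₁ hQP₂).trans (add_le_add_right hP _), ?_⟩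
  rw [vcat_hcat_zero_eq hlm hmn, Matrix.mul_assoc]
  refine (norm_sub_hcat_le hlm _ _ _).trans ?_
  rw [leftCols_mul, leftCols_mul, rightCols_mul, rightCols_mul]
  calc ‖diagOne hln Q₂ * (Q₁ * leftCols hlm A) - vcat RL 0‖ +
        ‖diagOne hln Q₂ * (Q₁ * rightCols hlm A) - vcat (topRows hln AR) (vcat RR 0)‖
      ≤ a₁ * ‖leftCols hlm A‖ + (a₂ * ‖bottomRows hln AR‖ + (e + q₁) * ‖A‖) :=
        add_le_add ((norm_diagOne_mul_sub_vcat_zero_le hln hQ₂ _ _).trans hQA₁)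
          ((norm_diagOne_mul_sub_vcat_topRows_le hln hQ₂ _ _ _).trans (add_le_add hQA₂ hright))
    _ ≤ a₁ * ‖A‖ + (a₂ * ((1 + (e + q₁)) * ‖A‖) + (e + q₁) * ‖A‖) := by
        gcongr
        exact norm_leftCols_le hlm A
    _ = (a₁ + (e + q₁) + a₂ * (1 + (e + q₁))) * ‖A‖ := by ring

end Triangularization

section WYRepresentation

variable {n m l : ℕ}

/-- `R`, `W`, `Y` form an approximate QR decomposition `(I - W Y) A ≈ [R; 0]`, with errors `q` and
`a` as in `IsApproxTriangularization`. The bounds on `W` and `Y` have a margin that absorbs the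
rounding errors of the recursion. -/
structure IsApproxQR (A : Matrix (Fin n) (Fin m) ℝ) (R : Matrix (Fin m) (Fin m) ℝ)
    (W : Matrix (Fin n) (Fin m) ℝ) (Y : Matrix (Fin m) (Fin n) ℝ) (q a : ℝ) : Prop where
  blockTriangular : R.BlockTriangular id
  norm_W_le : ‖W‖ ≤ 3 * m - 1
  norm_Y_le : ‖Y‖ ≤ 3 * m
  triangularization : IsApproxTriangularization A R (1 - W * Y) q a

theorem IsApproxQR.mono {A : Matrix (Fin n) (Fin m) ℝ} {R : Matrix (Fin m) (Fin m) ℝ}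
    {W : Matrix (Fin n) (Fin m) ℝ} {Y : Matrix (Fin m) (Fin n) ℝ} {q q' a a' : ℝ}
    (h : IsApproxQR A R W Y q a) (hq : q ≤ q') (ha : a ≤ a') : IsApproxQR A R W Y q' a' :=
  { h with triangularization := h.triangularization.mono hq ha }

theorem blockTriangular_vcat_hcat {R : Type} [CommRing R] (h : l ≤ n)
    {A : Matrix (Fin l) (Fin l) R} {B : Matrix (Fin l) (Fin (n - l)) R}
    {D : Matrix (Fin (n - l)) (Fin (n - l)) R} (hA : A.BlockTriangular id)
    (hD : D.BlockTriangular id) :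
    (vcat (hcat A B) (hcat 0 D) : Matrix (Fin n) (Fin n) R).BlockTriangular id := by
  intro i j hij
  obtain ⟨i, rfl⟩ | ⟨i, rfl⟩ := castLE_or_upperIdx h i <;>
    obtain ⟨j, rfl⟩ | ⟨j, rfl⟩ := castLE_or_upperIdx h j <;>
    simp only [vcat, hcat, Matrix.of_apply, glue_castLE, glue_upperIdx, Matrix.zero_apply]
  · exact hA hij
  · simp only [id, Fin.lt_def, upperIdx, Fin.val_castLE] at hij
    omega
  · exact hD (Nat.lt_of_add_lt_add_left hij)

theorem vcat_topRows_eq_diagOne_mul {R : Type} [CommRing R] {k : ℕ} (h : l ≤ n)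
    (P : Matrix (Fin (n - l)) (Fin (n - l)) R) (A : Matrix (Fin n) (Fin k) R)
    (B : Matrix (Fin (n - l)) (Fin k) R) :
    vcat (topRows h A) B = diagOne h P * A + botEmb R h * (B - P * bottomRows h A) := by
  rw [vcat_eq h, diagOne_mul, Matrix.mul_sub]
  abel

theorem hcat_mul_vcat {R : Type} [CommRing R] (h : l ≤ m) (A : Matrix (Fin n) (Fin l) R)
    (B : Matrix (Fin n) (Fin (m - l)) R) (C : Matrix (Fin l) (Fin n) R)
    (D : Matrix (Fin (m - l)) (Fin n) R) :
    (hcat A B : Matrix (Fin n) (Fin m) R) * vcat C D = A * C + B * D := by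
  simp only [hcat_eq h, vcat_eq h, Matrix.add_mul, Matrix.mul_add, Matrix.mul_assoc]
  simp only [← Matrix.mul_assoc (Matrix.transpose _), topEmb_transpose_mul_topEmb,
    topEmb_transpose_mul_botEmb, botEmb_transpose_mul_topEmb, botEmb_transpose_mul_botEmb,
    Matrix.one_mul, Matrix.zero_mul, Matrix.mul_zero, add_zero, zero_add]

theorem one_sub_hcat_mul_vcat {R : Type} [CommRing R] (hlm : l ≤ m) (hln : l ≤ n)
    (WL : Matrix (Fin n) (Fin l) R) (YL : Matrix (Fin l) (Fin n) R)
    (WR : Matrix (Fin (n - l)) (Fin (m - l)) R) (YR : Matrix (Fin (m - l)) (Fin (n - l)) R)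
    (XB : Matrix (Fin (n - l)) (Fin l) R) :
    1 - (hcat (vcat (topRows hln WL) XB) (vcat 0 WR) : Matrix (Fin n) (Fin m) R) *
        vcat YL (hcat 0 YR) =
      diagOne hln (1 - WR * YR) * (1 - WL * YL) -
        botEmb R hln * (XB - (1 - WR * YR) * bottomRows hln WL) * YL := by
  have hone : diagOne hln (1 - WR * YR) = 1 - vcat 0 WR * hcat 0 YR := by
    rw [vcat_eq hln, hcat_eq hln, ← topEmb_mul_transpose_add_botEmb_mul_transpose hln, diagOne]
    simp only [Matrix.mul_zero, Matrix.zero_mul, zero_add, Matrix.mul_sub, Matrix.sub_mul,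
      Matrix.mul_one, Matrix.mul_assoc]
    abel
  rw [hcat_mul_vcat hlm, vcat_topRows_eq_diagOne_mul hln (1 - WR * YR),
    Matrix.mul_sub (diagOne hln _), Matrix.mul_one, Matrix.add_mul, ← Matrix.mul_assoc]
  nth_rewrite 2 [hone]
  abel

theorem IsApproxQR.glue (hlm : l ≤ m) (hmn : m ≤ n) {A : Matrix (Fin n) (Fin m) ℝ}
    {RL : Matrix (Fin l) (Fin l) ℝ} {WL : Matrix (Fin n) (Fin l) ℝ}
    {YL : Matrix (Fin l) (Fin n) ℝ} {AR : Matrix (Fin n) (Fin (m - l)) ℝ}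
    {RR : Matrix (Fin (m - l)) (Fin (m - l)) ℝ} {WR : Matrix (Fin (n - l)) (Fin (m - l)) ℝ}
    {YR : Matrix (Fin (m - l)) (Fin (n - l)) ℝ} {XB : Matrix (Fin (n - l)) (Fin l) ℝ}
    {q₁ a₁ q₂ a₂ e : ℝ} (ha₁ : 0 ≤ a₁) (ha₂ : 0 ≤ a₂) (he : 0 ≤ e) (hq₂ : (q₂ + e) * (3 * l) ≤ 1)
    (hL : IsApproxQR (leftCols hlm A) RL WL YL q₁ a₁)
    (hAR : ‖AR - (1 - WL * YL) * rightCols hlm A‖ ≤ e * ‖rightCols hlm A‖)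
    (hR : IsApproxQR (bottomRows (hlm.trans hmn) AR) RR WR YR q₂ a₂)
    (hXB : ‖XB - (1 - WR * YR) * bottomRows (hlm.trans hmn) WL‖ ≤
      e * ‖bottomRows (hlm.trans hmn) WL‖) :
    IsApproxQR A (vcat (hcat RL (topRows (hlm.trans hmn) AR)) (hcat 0 RR))
      (hcat (vcat (topRows (hlm.trans hmn) WL) XB) (vcat 0 WR)) (vcat YL (hcat 0 YR))
      (q₁ + q₂ * (1 + q₁) + 9 * l ^ 2 * e) (a₁ + (e + q₁) + a₂ * (1 + (e + q₁))) := by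
  set hln := hlm.trans hmn
  have hWL : ‖WL‖ ≤ 3 * l := hL.norm_W_le.trans (by linarith)
  have hXB' : ‖botEmb ℝ hln * (XB - (1 - WR * YR) * bottomRows hln WL)‖ ≤ e * (3 * l) :=
    (norm_botEmb_mul_le hln _).trans
      (hXB.trans (mul_le_mul_of_nonneg_left ((norm_bottomRows_le hln WL).trans hWL) he))
  refine ⟨blockTriangular_vcat_hcat hlm hL.blockTriangular hR.blockTriangular, ?_, ?_,
    hL.triangularization.glue hlm hmn ha₁ ha₂ he hAR hR.triangularization ?_⟩
  · obtain ⟨Q₂, hQ₂, hQP₂, -⟩ := hR.triangularization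
    have hX : ‖(vcat (topRows hln WL) XB : Matrix (Fin n) (Fin l) ℝ)‖ ≤
        (3 * l - 1) + (q₂ + e) * (3 * l) := by
      rw [vcat_topRows_eq_diagOne_mul hln (1 - WR * YR)]
      have hD := norm_diagOne_le_of_norm_sub_le hln hQ₂ hQP₂
      have hq₂' : 0 ≤ q₂ := (norm_nonneg _).trans hQP₂
      refine (norm_add_le_of_le (l2_opNorm_mul_le_of_le hD le_rfl) hXB').trans ?_
      linarith [hL.norm_W_le, mul_le_mul_of_nonneg_left hWL hq₂']
    have hWR : ‖(vcat 0 WR : Matrix (Fin n) (Fin (m - l)) ℝ)‖ ≤ 3 * (m - l : ℕ) - 1 :=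
      (norm_vcat_le hln 0 WR).trans (by simpa using hR.norm_W_le)
    push_cast [hlm] at hWR
    linarith [norm_hcat_le hlm (vcat (topRows hln WL) XB : Matrix (Fin n) (Fin l) ℝ)
      (vcat 0 WR : Matrix (Fin n) (Fin (m - l)) ℝ)]
  · have hYR : ‖(hcat 0 YR : Matrix (Fin (m - l)) (Fin n) ℝ)‖ ≤ 3 * (m - l : ℕ) :=
      (norm_hcat_le hln 0 YR).trans (by simpa using hR.norm_Y_le)
    push_cast [hlm] at hYR
    linarith [norm_vcat_le hlm YL (hcat 0 YR : Matrix (Fin (m - l)) (Fin n) ℝ), hL.norm_Y_le]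
  · rw [one_sub_hcat_mul_vcat hlm hln, sub_sub_cancel_left, norm_neg]
    refine (l2_opNorm_mul_le_of_le hXB' hL.norm_Y_le).trans_eq ?_
    ring

end WYRepresentation

/-! ### Backward stability -/

theorem norm_vecMulVec_sub_vecMulVec_le {n m : ℕ} {u w : EuclideanSpace ℝ (Fin n)}
    {v y : EuclideanSpace ℝ (Fin m)} {a b : ℝ} (hw : ‖w - u‖ ≤ a) (hy : ‖y - v‖ ≤ b) :
    ‖Matrix.vecMulVec w.ofLp y.ofLp - Matrix.vecMulVec u.ofLp v.ofLp‖ ≤ a * ‖y‖ + ‖u‖ * b := by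
  have hsplit : Matrix.vecMulVec w.ofLp y.ofLp - Matrix.vecMulVec u.ofLp v.ofLp =
      Matrix.vecMulVec (w - u).ofLp y.ofLp + Matrix.vecMulVec u.ofLp (y - v).ofLp := by
    rw [WithLp.ofLp_sub, WithLp.ofLp_sub, Matrix.sub_vecMulVec, Matrix.vecMulVec_sub,
      sub_add_sub_cancel]
  rw [hsplit]
  exact norm_add_le_of_le ((l2_opNorm_vecMulVec_le _ _).trans (by gcongr))
    ((l2_opNorm_vecMulVec_le _ _).trans (by gcongr))

theorem vcat_of_fun_eq_replicateCol_single {n : ℕ} (hn : 1 ≤ n) (ρ : ℝ) :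
    (vcat (Matrix.of fun _ _ => ρ : Matrix (Fin 1) (Fin 1) ℝ) 0 : Matrix (Fin n) (Fin 1) ℝ) =
      Matrix.replicateCol (Fin 1) (Pi.single ⟨0, hn⟩ ρ) := by
  ext i j
  obtain ⟨i, rfl⟩ | ⟨i, rfl⟩ := castLE_or_upperIdx hn i
  · have hi : Fin.castLE hn i = ⟨0, hn⟩ := Fin.ext (by simp)
    rw [Matrix.replicateCol_apply, hi, Pi.single_eq_same, vcat, Matrix.of_apply, ← hi]
    exact glue_castLE hn (fun _ => ρ) (fun _ => 0) i
  · have hi : upperIdx hn i ≠ ⟨0, hn⟩ := fun h => by simp [upperIdx] at h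
    simp [vcat, glue_upperIdx, hi]

theorem isApproxQR_of_exec_householder {n : ℕ} {hn : 0 < n} {A : Matrix (Fin n) (Fin 1) ℝ}
    {w y : Fin n → ℝ} {ε η ρ : ℝ} {t : ℕ} (hε : 0 ≤ ε) (hη : (2 * n + 4) * ε ≤ η)
    (hη1 : 100 * η ≤ 1) (h : (householder hn fun i => A i 0).Exec ε (ρ, w, y) t) :
    IsApproxQR A (Matrix.of fun _ _ => ρ) (Matrix.replicateCol (Fin 1) w)
      (Matrix.replicateRow (Fin 1) y) (75 * η) (2 * η) := by
  obtain ⟨u, g, hu, hwu, hyu, hρ, hreflect⟩ := exists_reflection_near_householder hε hη hη1 h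
  have hη0 : 0 ≤ η := le_trans (by positivity) hη
  have hw : ‖toLp 2 w‖ ≤ 1 + 17 * η :=
    (norm_le_norm_add_norm_sub' _ u).trans (add_le_add hu.le hwu)
  have hy : ‖toLp 2 y‖ ≤ 2 + 35 * η :=
    (norm_le_norm_add_norm_sub' _ ((2 : ℝ) • u)).trans
      (add_le_add (by rw [norm_smul, hu]; norm_num) hyu)
  have hA : A = Matrix.replicateCol (Fin 1) fun i => A i 0 := by
    ext i j
    rw [Subsingleton.elim j 0, Matrix.replicateCol_apply]
  have hu' : u.ofLp ⬝ᵥ u.ofLp = 1 := by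
    calc u.ofLp ⬝ᵥ u.ofLp = inner ℝ u u := by
          rw [EuclideanSpace.inner_eq_star_dotProduct, star_trivial]
      _ = 1 := by rw [real_inner_self_eq_norm_sq, hu, one_pow]
  have hWY : Matrix.replicateCol (Fin 1) w * Matrix.replicateRow (Fin 1) y =
      Matrix.vecMulVec w y := by
    ext i j
    simp [Matrix.mul_apply, Matrix.vecMulVec_apply]
  have hortho : 1 - Matrix.vecMulVec u.ofLp ((2 : ℝ) • u.ofLp) ∈
      Matrix.orthogonalGroup (Fin n) ℝ :=
    one_sub_vecMulVec_two_smul_mem_orthogonalGroup hu'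
  refine ⟨fun i j hij => absurd hij (by simp [Subsingleton.elim i j]), ?_, ?_, _, hortho, ?_, ?_⟩
  · rw [l2_opNorm_replicateCol]
    push_cast
    linarith
  · rw [l2_opNorm_replicateRow]
    push_cast
    linarith
  · rw [hWY, sub_sub_sub_cancel_left]
    refine (norm_vecMulVec_sub_vecMulVec_le hwu hyu).trans ?_
    rw [hu]
    nlinarith [norm_nonneg (toLp 2 y)]
  · rw [vcat_of_fun_eq_replicateCol_single hn, hA, ← Matrix.replicateCol_mulVec, hreflect,
      l2_opNorm_replicateCol]
    have hsub : Matrix.replicateCol (Fin 1) (Pi.single (⟨0, hn⟩ : Fin n) g) -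
        Matrix.replicateCol (Fin 1) (Pi.single ⟨0, hn⟩ ρ) =
        Matrix.replicateCol (Fin 1) (Pi.single ⟨0, hn⟩ (g - ρ)) := by
      rw [Pi.single_sub]
      rfl
    rw [hsub, l2_opNorm_replicateCol]
    exact (PiLp.norm_single 2 (fun _ => ℝ) _ _).trans_le ((norm_sub_rev _ _).trans_le hρ)

/-- Since `(2 l - 1) + (2 (m - l) - 1) + 1 = 2 m - 1`, gluing adds no more than one further `β` to
the sum of the errors of the two halves. -/
theorem IsApproxQR.glue_of_le {n m l : ℕ} (hl : 1 ≤ l) (hlm : l < m) (hmn : m ≤ n)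
    {A : Matrix (Fin n) (Fin m) ℝ} {RL : Matrix (Fin l) (Fin l) ℝ} {WL : Matrix (Fin n) (Fin l) ℝ}
    {YL : Matrix (Fin l) (Fin n) ℝ} {AR : Matrix (Fin n) (Fin (m - l)) ℝ}
    {RR : Matrix (Fin (m - l)) (Fin (m - l)) ℝ} {WR : Matrix (Fin (n - l)) (Fin (m - l)) ℝ}
    {YR : Matrix (Fin (m - l)) (Fin (n - l)) ℝ} {XB : Matrix (Fin (n - l)) (Fin l) ℝ}
    {N e β : ℝ} (h2l : 2 * l ≤ N) (hmN : m ≤ N) (he : 0 ≤ e) (heβ : 18 * N ^ 2 * e ≤ β)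
    (hβ : 8 * N ^ 2 * β ≤ 1)
    (hL : IsApproxQR (leftCols hlm.le A) RL WL YL ((2 * l - 1) * β) ((2 * l - 1) * (2 * N * β)))
    (hAR : ‖AR - (1 - WL * YL) * rightCols hlm.le A‖ ≤ e * ‖rightCols hlm.le A‖)
    (hR : IsApproxQR (bottomRows (hlm.le.trans hmn) AR) RR WR YR
      ((2 * (m - l : ℕ) - 1) * β) ((2 * (m - l : ℕ) - 1) * (2 * N * β)))
    (hXB : ‖XB - (1 - WR * YR) * bottomRows (hlm.le.trans hmn) WL‖ ≤
      e * ‖bottomRows (hlm.le.trans hmn) WL‖) :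
    IsApproxQR A (vcat (hcat RL (topRows (hlm.le.trans hmn) AR)) (hcat 0 RR))
      (hcat (vcat (topRows (hlm.le.trans hmn) WL) XB) (vcat 0 WR)) (vcat YL (hcat 0 YR))
      ((2 * m - 1) * β) ((2 * m - 1) * (2 * N * β)) := by
  have hl' : (1 : ℝ) ≤ l := by exact_mod_cast hl
  have hr : (1 : ℝ) ≤ (m - l : ℕ) := by exact_mod_cast Nat.sub_pos_of_lt hlm
  have hsum : (l : ℝ) + (m - l : ℕ) = m := by exact_mod_cast Nat.add_sub_cancel' hlm.le
  generalize ((m - l : ℕ) : ℝ) = r at hr hsum hR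
  have hN : 1 ≤ N := by linarith
  have : 0 ≤ β := le_trans (by positivity) heβ
  have hl0 : 0 ≤ 2 * (l : ℝ) - 1 := by linarith
  have hr0 : 0 ≤ 2 * r - 1 := by linarith
  have heβ' : e ≤ β := by nlinarith [one_le_pow₀ hN (n := 2)]
  have hq₁ : (2 * l - 1) * β ≤ 2 * N * β := by gcongr; linarith
  have heq₁ : e + (2 * l - 1) * β ≤ N * β := by nlinarith
  have heq₂ : (2 * r - 1) * β + e ≤ 2 * N * β := by nlinarith
  have ha₂ : (2 * r - 1) * (2 * N * β) ≤ 1 := by nlinarith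
  have hqq : (2 * r - 1) * β * ((2 * l - 1) * β) ≤ β / 2 := by
    calc (2 * r - 1) * β * ((2 * l - 1) * β) ≤ 2 * N * β * (2 * N * β) := by
          gcongr
          linarith
      _ = 8 * N ^ 2 * β * (β / 2) := by ring
      _ ≤ β / 2 := mul_le_of_le_one_left (by positivity) hβ
  have hf : 9 * l ^ 2 * e ≤ β / 2 := by
    calc 9 * l ^ 2 * e ≤ 9 * N ^ 2 * e := by gcongr; linarith
      _ ≤ β / 2 := by linarith
  refine (IsApproxQR.glue hlm.le hmn ?_ ?_ he ?_ hL hAR hR hXB).mono ?_ ?_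
  · positivity
  · positivity
  · calc ((2 * r - 1) * β + e) * (3 * l) ≤ 2 * N * β * (3 * N) := by gcongr; linarith
      _ ≤ 1 := by linarith
  · rw [← hsum]
    linarith
  · have hae := mul_le_of_le_one_left (by positivity : 0 ≤ e + (2 * l - 1) * β) ha₂
    rw [← hsum]
    linarith

theorem isApproxQR_of_exec {mm : MatMul} {N : ℕ} {ε κ β : ℝ} (hε : 0 ≤ ε) (hκ : 0 ≤ κ)
    (hκ1 : κ ≤ 1) (hmm : mm.IsRectAccurate N ε κ) (hβ : 75 * (2 * N + 4) * ε ≤ β)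
    (hβκ : 18 * N ^ 2 * (27 * N ^ 2 * κ + 37 * N ^ 3 * ε) ≤ β) (hβ1 : 8 * N ^ 2 * β ≤ 1)
    {n m : ℕ} (hm : 1 ≤ m) (hmn : m ≤ n) (hnN : n ≤ N) {A : Matrix (Fin n) (Fin m) ℝ}
    {R : Matrix (Fin m) (Fin m) ℝ} {W : Matrix (Fin n) (Fin m) ℝ} {Y : Matrix (Fin m) (Fin n) ℝ}
    {t : ℕ} (h : (qrr mm n m hmn A).Exec ε (R, W, Y) t) :
    IsApproxQR A R W Y ((2 * m - 1) * β) ((2 * m - 1) * (2 * N * β)) := by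
  have : 0 ≤ β := le_trans (by positivity) hβ
  have hN : (1 : ℝ) ≤ N := by exact_mod_cast hm.trans (hmn.trans hnN)
  induction m using Nat.strong_induction_on generalizing n t with
  | _ m ih =>
  obtain rfl | hm2 := hm.eq_or_lt
  · obtain ⟨ρ, w, y, hhouse, rfl, rfl, rfl⟩ := exec_qrr_one h
    have hη : (2 * n + 4) * ε ≤ (2 * N + 4) * ε := by gcongr
    refine (isApproxQR_of_exec_householder hε hη (by nlinarith) hhouse).mono ?_ ?_
    · push_cast
      linarith
    · push_cast
      nlinarith
  · obtain ⟨l, hl⟩ : ∃ l, l = m / 2 := ⟨_, rfl⟩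
    have hlm : l < m := by omega
    obtain ⟨RL, WL, YL, AR, RR, WR, YR, XB, _, _, _, _, hL, hAR, hR, hXB, rfl, rfl, rfl, -⟩ :=
      exec_qrr_of_two_le hm2 hl hlm.le hmn h
    have hL := ih l hlm (by omega) (hlm.le.trans hmn) hnN hL
    have hR := ih (m - l) (by omega) (by omega) (by omega) (by omega) hR
    have hmN : (m : ℝ) ≤ N := by exact_mod_cast hmn.trans hnN
    have h2l : 2 * (l : ℝ) ≤ N := by exact_mod_cast (by omega : 2 * l ≤ N)
    have hrm : ((m - l : ℕ) : ℝ) ≤ N := by exact_mod_cast (by omega : m - l ≤ N)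
    have hAR := norm_wyApply_sub_le hnN (by omega) (by omega) hε hκ hκ1 hmm
      (hL.norm_W_le.trans (by linarith : _ ≤ 3 * (N : ℝ))) (hL.norm_Y_le.trans (by linarith)) hAR
    have hXB := norm_wyApply_sub_le (by omega) (by omega) (by omega) hε hκ hκ1 hmm
      (hR.norm_W_le.trans (by linarith : _ ≤ 3 * (N : ℝ))) (hR.norm_Y_le.trans (by linarith)) hXB
    have hN2 : 1 + 4 * (3 * (N : ℝ)) ^ 2 ≤ 37 * N ^ 2 := by
      linarith [one_le_pow₀ hN (n := 2)]
    have hκN : 3 * (3 * N) ^ 2 * κ + N * ε * (1 + 4 * (3 * N) ^ 2) ≤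
        27 * N ^ 2 * κ + 37 * N ^ 3 * ε := by
      linarith [mul_le_mul_of_nonneg_left hN2 (by positivity : 0 ≤ N * ε)]
    exact hL.glue_of_le (by omega) hlm hmn h2l hmN (by positivity)
      ((mul_le_mul_of_nonneg_left hκN (by positivity)).trans hβκ) hβ1 hAR hR hXB

section Asymptotics

open Filter Topology

variable {mm : MatMul}

theorem eventually_mul_le_one (c : ℝ) : ∀ᶠ ε in 𝓝[>] (0 : ℝ), c * ε ≤ 1 := by
  have hlim : Tendsto (fun ε : ℝ => c * ε) (𝓝 0) (𝓝 0) := by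
    simpa using (continuous_const_mul c).tendsto 0
  exact (hlim.mono_left nhdsWithin_le_nhds).eventually_le_const one_pos

theorem MatMul.IsStable.eventually_isAccurate (h : mm.IsStable) :
    ∃ (M : ℝ) (c : ℕ), 0 ≤ M ∧
      ∀ N : ℕ, ∀ᶠ ε in 𝓝[>] (0 : ℝ), mm.IsAccurate N ε (M * N ^ c * ε) := by
  obtain ⟨M, c, h⟩ := h
  refine ⟨|M| + 1, c, by positivity, fun N => ?_⟩
  suffices ∀ᶠ ε in 𝓝[>] (0 : ℝ), ∀ k ∈ Finset.Icc 1 N,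
      ∀ (A B P : Matrix (Fin k) (Fin k) ℝ) (t : ℕ), (mm ℝ k A B).Exec ε P t →
        ‖P - A * B‖ ≤ (|M| + 1) * N ^ c * ε * (‖A‖ * ‖B‖) from
    this.mono fun ε h k hk hkN => h k (Finset.mem_Icc.2 ⟨hk, hkN⟩)
  rw [Finset.eventually_all]
  intro k hk
  obtain ⟨hk, hkN⟩ := Finset.mem_Icc.1 hk
  obtain ⟨L, ε₁, hε₁, h⟩ := h k hk
  filter_upwards [self_mem_nhdsWithin, eventually_mul_le_one L, Ioc_mem_nhdsGT hε₁]
    with ε (hε : 0 < ε) hL hεε₁ A B P t hP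
  have hkc : (1 : ℝ) ≤ N ^ c := one_le_pow₀ (by exact_mod_cast hk.trans hkN)
  have hMk : M * (k : ℝ) ^ c ≤ |M| * N ^ c := by
    gcongr
    exact le_abs_self M
  calc ‖P - A * B‖ ≤ M * k ^ c * ε * ‖A‖ * ‖B‖ + L * ε ^ 2 * ‖A‖ * ‖B‖ :=
        h ε hε hεε₁.2 A B P t hP
    _ = (M * k ^ c + L * ε) * ε * (‖A‖ * ‖B‖) := by ring
    _ ≤ (|M| + 1) * N ^ c * ε * (‖A‖ * ‖B‖) := by
        gcongr
        linarith

theorem MatMul.IsStable.eventually_isRectAccurate (h : mm.IsStable) :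
    ∃ (D : ℝ) (d : ℕ), 0 ≤ D ∧
      ∀ N : ℕ, 1 ≤ N → ∀ᶠ ε in 𝓝[>] (0 : ℝ), mm.IsRectAccurate N ε (D * N ^ d * ε) := by
  obtain ⟨M, c, hM, hacc⟩ := h.eventually_isAccurate
  refine ⟨M + 2, c + 6, by positivity, fun N hN => ?_⟩
  have hN : (1 : ℝ) ≤ N := by exact_mod_cast hN
  filter_upwards [hacc N, self_mem_nhdsWithin, eventually_mul_le_one (M * N ^ c + 2 * N ^ 2)]
    with ε hacc (hε : 0 < ε) hsmall p q r hp hq hr A B P t hP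
  refine (hacc.isRectAccurate hε.le (by positivity) (by linarith) p q r hp hq hr A B P t
    hP).trans ?_
  have hc : (N : ℝ) ^ (c + 4) ≤ N ^ (c + 6) := pow_le_pow_right₀ hN (by omega)
  have h6 : (N : ℝ) ^ 6 ≤ N ^ (c + 6) := pow_le_pow_right₀ hN (by omega)
  refine mul_le_mul_of_nonneg_right ?_ (by positivity)
  calc N ^ 4 * (M * N ^ c * ε + 2 * N ^ 2 * ε) = (M * (N : ℝ) ^ (c + 4) + 2 * N ^ 6) * ε := by ring
    _ ≤ (M * N ^ (c + 6) + 2 * N ^ (c + 6)) * ε := by gcongr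
    _ = (M + 2) * N ^ (c + 6) * ε := by ring

theorem MatMul.IsStable.eventually_isApproxQR (hmm : mm.IsStable) :
    ∃ (K : ℝ) (c : ℕ), 0 ≤ K ∧ ∀ n m : ℕ, 1 ≤ m → ∀ h : m ≤ n, ∀ᶠ ε in 𝓝[>] (0 : ℝ),
      ∀ (A : Matrix (Fin n) (Fin m) ℝ) (R : Matrix (Fin m) (Fin m) ℝ)
        (W : Matrix (Fin n) (Fin m) ℝ) (Y : Matrix (Fin m) (Fin n) ℝ) (t : ℕ),
        (qrr mm n m h A).Exec ε (R, W, Y) t →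
          IsApproxQR A R W Y (K * n ^ c * ε) (K * n ^ c * ε) := by
  obtain ⟨D, d, hD, hrect⟩ := hmm.eventually_isRectAccurate
  set K := 18 * (27 * D + 37) + 450 with hK
  have : 0 ≤ K := by positivity
  refine ⟨4 * K, d + 7, by positivity, fun n m hm hmn => ?_⟩
  have hn : (1 : ℝ) ≤ n := by exact_mod_cast hm.trans hmn
  have hmn' : (m : ℝ) ≤ n := by exact_mod_cast hmn
  have hm' : (1 : ℝ) ≤ m := by exact_mod_cast hm
  have hpow : ∀ {i}, i ≤ d + 5 → (n : ℝ) ^ i ≤ n ^ (d + 5) := pow_le_pow_right₀ hn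
  filter_upwards [hrect n (hm.trans hmn), self_mem_nhdsWithin,
    eventually_mul_le_one (D * n ^ d), eventually_mul_le_one (8 * n ^ 2 * (K * n ^ (d + 5)))]
    with ε hrect (hε : 0 < ε) hκ1 hβ1 A R W Y t hqrr
  obtain ⟨β, hβ⟩ : ∃ β, β = K * n ^ (d + 5) * ε := ⟨_, rfl⟩
  have : 0 ≤ β := by rw [hβ]; positivity
  have hhouse : 75 * (2 * n + 4) * ε ≤ β := by
    have h1 : (n : ℝ) ≤ n ^ (d + 5) := by simpa using hpow (i := 1) (by omega)
    calc 75 * (2 * n + 4) * ε ≤ 450 * n * ε :=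
          mul_le_mul_of_nonneg_right (by linarith) hε.le
      _ ≤ 450 * n ^ (d + 5) * ε := by gcongr
      _ ≤ β := by rw [hβ, hK]; gcongr; linarith
  have hglue : 18 * n ^ 2 * (27 * n ^ 2 * (D * n ^ d * ε) + 37 * n ^ 3 * ε) ≤ β := by
    calc 18 * n ^ 2 * (27 * n ^ 2 * (D * n ^ d * ε) + 37 * n ^ 3 * ε)
        = 18 * (27 * D * (n : ℝ) ^ (d + 4) + 37 * n ^ 5) * ε := by ring
      _ ≤ 18 * (27 * D * n ^ (d + 5) + 37 * n ^ (d + 5)) * ε := by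
          gcongr 18 * (27 * D * ?_ + 37 * ?_) * ε
          exacts [hpow (by omega), hpow (by omega)]
      _ = 18 * (27 * D + 37) * n ^ (d + 5) * ε := by ring
      _ ≤ β := by rw [hβ, hK]; gcongr; linarith
  have hfinal : (2 * m - 1) * (2 * n * β) ≤ 4 * K * n ^ (d + 7) * ε := by
    calc (2 * m - 1) * (2 * n * β) ≤ 2 * n * (2 * n * β) := by gcongr; linarith
      _ = 4 * K * n ^ (d + 7) * ε := by rw [hβ]; ring
  refine (isApproxQR_of_exec hε.le (by positivity) hκ1 hrect hhouse hglue (by rw [hβ]; linarith)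
    hm hmn le_rfl hqrr).mono (le_trans ?_ hfinal) hfinal
  gcongr
  · linarith
  · nlinarith

theorem MatMul.IsStable.eventually_exists_perturbation (hmm : mm.IsStable) :
    ∃ (K : ℝ) (c : ℕ), ∀ (n m : ℕ) (h : m ≤ n), ∀ᶠ ε in 𝓝[>] (0 : ℝ),
      ∀ (A : Matrix (Fin n) (Fin m) ℝ) (R : Matrix (Fin m) (Fin m) ℝ)
        (W : Matrix (Fin n) (Fin m) ℝ) (Y : Matrix (Fin m) (Fin n) ℝ) (t : ℕ),
        (qrr mm n m h A).Exec ε (R, W, Y) t → R.BlockTriangular id ∧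
          ∃ (δQ : Matrix (Fin n) (Fin n) ℝ) (δA : Matrix (Fin n) (Fin m) ℝ),
            1 - W * Y + δQ ∈ Matrix.orthogonalGroup (Fin n) ℝ ∧
            (1 - W * Y + δQ) * (A + δA) = vcat R 0 ∧
            ‖δQ‖ ≤ K * n ^ c * ε ∧ ‖δA‖ ≤ K * n ^ c * ε * ‖A‖ := by
  obtain ⟨K, c, hK, hqr⟩ := hmm.eventually_isApproxQR
  refine ⟨K, c, fun n m h => ?_⟩
  obtain rfl | hm := m.eq_zero_or_pos
  · filter_upwards [self_mem_nhdsWithin] with ε (hε : 0 < ε) A R W Y t _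
    have hP : 1 - W * Y = 1 := by
      ext i j
      simp
    refine ⟨fun i => i.elim0, 0, 0, ?_, Matrix.ext fun i j => j.elim0, ?_, ?_⟩
    · rw [hP, add_zero]
      exact one_mem _
    · rw [norm_zero]
      positivity
    · rw [norm_zero]
      positivity
  · filter_upwards [hqr n m hm h] with ε hqr A R W Y t hexec
    have hQR := hqr A R W Y t hexec
    exact ⟨hQR.blockTriangular, hQR.triangularization.exists_perturbation⟩

end Asymptotics

/-! ### Operation counts -/

/-- With machine epsilon `ε`, the routine takes at most `C * k ^ γ` operations to multiply square
matrices of order `k ≥ 1`. -/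
def MatMul.HasCostBound (mm : MatMul) (ε C γ : ℝ) : Prop :=
  ∀ k : ℕ, 1 ≤ k → ∀ (A B P : Matrix (Fin k) (Fin k) ℝ) (t : ℕ),
    (mm ℝ k A B).Exec ε P t → (t : ℝ) ≤ C * (k : ℝ) ^ γ

section Cost

variable {mm : MatMul} {ε C γ : ℝ}

theorem exec_blockSum_cost {k b t : ℕ} (hk : 1 ≤ k) (hmm : mm.HasCostBound ε C γ)
    {Z S : Matrix (Fin k) (Fin k) ℝ} {X Y : ℕ → Matrix (Fin k) (Fin k) ℝ}
    (h : (blockSum mm b Z X Y).Exec ε S t) : (t : ℝ) ≤ b * (C * (k : ℝ) ^ γ + k ^ 2) := by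
  have hloop := Exec.foldlM (fun l _ t => (t : ℝ) ≤ l.length * (C * (k : ℝ) ^ γ + k ^ 2)) ?_
    (by simp) h
  · rwa [List.length_range] at hloop
  intro l K S S' s u hs hS'
  simp only [exec_bind] at hS'
  obtain ⟨P, tP, tS, hP, hS', rfl⟩ := hS'
  have htP := hmm k hk _ _ _ _ hP
  rw [(exec_matAdd hS').2, List.length_append, List.length_singleton]
  push_cast
  linarith

theorem cast_ceilDiv_le {p k : ℕ} (hkp : k ≤ p) :
    (((p + k - 1) / k : ℕ) : ℝ) ≤ 2 * p / k := by
  refine Nat.cast_div_le.trans ?_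
  gcongr
  exact_mod_cast (by omega : p + k - 1 ≤ 2 * p)

theorem exec_rectMul_cost {p q r k t : ℕ} (hγ : 2 ≤ γ) (hC : 0 ≤ C) (hmm : mm.HasCostBound ε C γ)
    (hk : k = min p (min q r)) {A : Matrix (Fin p) (Fin q) ℝ} {B : Matrix (Fin q) (Fin r) ℝ}
    {P : Matrix (Fin p) (Fin r) ℝ} (h : (rectMul mm A B).Exec ε P t) :
    (t : ℝ) ≤ 8 * (C + 1) * (p * q * r * (k : ℝ) ^ (γ - 3)) := by
  obtain hk0 | hk0 := k.eq_zero_or_pos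
  · rw [(exec_rectMul_of_min_eq_zero (hk.symm.trans hk0) h).2, Nat.cast_zero]
    positivity
  obtain ⟨S, ts, hts, -, rfl⟩ := exec_rectMul hk hk0 h
  have hk1 : (1 : ℝ) ≤ k := by exact_mod_cast hk0
  have hkγ : (k : ℝ) ^ 2 ≤ (k : ℝ) ^ γ := by
    rw [← Real.rpow_natCast]
    exact Real.rpow_le_rpow_of_exponent_le hk1 (by exact_mod_cast hγ)
  have hblock : ∀ I J, (ts I J : ℝ) ≤ 2 * q / k * ((C + 1) * (k : ℝ) ^ γ) := fun I J => by
    refine (exec_blockSum_cost hk0 hmm (hts I J)).trans ?_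
    gcongr
    · exact cast_ceilDiv_le (by omega)
    · linarith
  push_cast
  calc ∑ I, ∑ J, (ts I J : ℝ)
      ≤ ∑ _I : Fin ((p + k - 1) / k), ∑ _J : Fin ((r + k - 1) / k),
          2 * q / k * ((C + 1) * (k : ℝ) ^ γ) :=
        Finset.sum_le_sum fun I _ => Finset.sum_le_sum fun J _ => hblock I J
    _ = ((p + k - 1) / k : ℕ) * (((r + k - 1) / k : ℕ) *
          (2 * q / k * ((C + 1) * (k : ℝ) ^ γ))) := by simp
    _ ≤ 2 * p / k * (2 * r / k * (2 * q / k * ((C + 1) * (k : ℝ) ^ γ))) := by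
        gcongr
        exacts [cast_ceilDiv_le (by omega), cast_ceilDiv_le (by omega)]
    _ = 8 * (C + 1) * (p * q * r * (k : ℝ) ^ (γ - 3)) := by
        rw [Real.rpow_sub (by positivity), Real.rpow_ofNat]
        field_simp
        ring

theorem mul_mul_min_rpow_le {a b s : ℝ} (hγ : 2 < γ) (ha : 0 ≤ a) (hb : 0 ≤ b) (has : a ≤ s)
    (hbs : b ≤ s) : a * b * min a b ^ (γ - 3) ≤ s ^ (γ - 1) := by
  have hmin : 0 ≤ min a b := le_min ha hb
  have hs : 0 ≤ s := ha.trans has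
  calc a * b * min a b ^ (γ - 3) = max a b * (min a b * min a b ^ (γ - 3)) := by
        rw [← min_mul_max a b]
        ring
    _ = max a b * min a b ^ (γ - 2) := by
        rw [← Real.rpow_one_add' hmin (by linarith)]
        ring_nf
    _ ≤ s * s ^ (γ - 2) := by
        gcongr
        exacts [max_le has hbs, min_le_of_left_le has]
    _ = s ^ (γ - 1) := by
        rw [← Real.rpow_one_add' hs (by linarith)]
        ring_nf

theorem exec_wyApply_cost {n m r s t : ℕ} (hγ : 2 < γ) (hC : 0 ≤ C)
    (hmm : mm.HasCostBound ε C γ) (hmn : m ≤ n) (hms : m ≤ s) (hrs : r ≤ s)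
    {W : Matrix (Fin n) (Fin m) ℝ} {Y : Matrix (Fin m) (Fin n) ℝ} {B Z : Matrix (Fin n) (Fin r) ℝ}
    (h : (wyApply mm W Y B).Exec ε Z t) :
    (t : ℝ) ≤ (16 * (C + 1) + 1) * (n * (s : ℝ) ^ (γ - 1)) := by
  simp only [wyApply, exec_bind] at h
  obtain ⟨YB, tYB, _, hYB, ⟨WYB, tWYB, _, hWYB, hZ, rfl⟩, rfl⟩ := h
  have hmin : (m : ℝ) * r * ((min m r : ℕ) : ℝ) ^ (γ - 3) ≤ (s : ℝ) ^ (γ - 1) := by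
    rw [Nat.cast_min]
    exact mul_mul_min_rpow_le hγ (by positivity) (by positivity) (by exact_mod_cast hms)
      (by exact_mod_cast hrs)
  have hr : (r : ℝ) ≤ (s : ℝ) ^ (γ - 1) := by
    obtain rfl | hs := s.eq_zero_or_pos
    · rw [Nat.le_zero.1 hrs, Nat.cast_zero]
      positivity
    · calc (r : ℝ) ≤ s := by exact_mod_cast hrs
        _ ≤ (s : ℝ) ^ (γ - 1) := Real.self_le_rpow_of_one_le (by exact_mod_cast hs) (by linarith)
  have hYB := exec_rectMul_cost hγ.le hC hmm (k := min m r) (by omega) hYB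
  have hWYB := exec_rectMul_cost hγ.le hC hmm (k := min m r) (by omega) hWYB
  have hC8 : 0 ≤ 8 * (C + 1) * n := by positivity
  rw [(exec_matSub hZ).2]
  push_cast
  linarith [mul_le_mul_of_nonneg_left hmin hC8,
    mul_le_mul_of_nonneg_left hr (Nat.cast_nonneg (α := ℝ) n)]

theorem rpow_add_rpow_le {a b s g θ : ℝ} (hg : 1 < g) (ha : 0 ≤ a) (hb : 0 ≤ b)
    (hab : a + b = s) (ha' : a ≤ θ * s) (hb' : b ≤ θ * s) (hθ : 0 ≤ θ) :
    a ^ g + b ^ g ≤ θ ^ (g - 1) * s ^ g := by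
  have hs : 0 ≤ s := by linarith
  have hsplit : ∀ x : ℝ, 0 ≤ x → x ^ g = x * x ^ (g - 1) := fun x hx => by
    rw [← Real.rpow_one_add' hx (by linarith), add_sub_cancel]
  calc a ^ g + b ^ g = a * a ^ (g - 1) + b * b ^ (g - 1) := by rw [hsplit a ha, hsplit b hb]
    _ ≤ a * (θ * s) ^ (g - 1) + b * (θ * s) ^ (g - 1) := by gcongr
    _ = s * (θ * s) ^ (g - 1) := by rw [← add_mul, hab]
    _ = θ ^ (g - 1) * s ^ g := by
        rw [Real.mul_rpow hθ hs, hsplit s hs]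
        ring

theorem exec_qrr_cost {K : ℝ} (hγ : 2 < γ) (hε : 0 ≤ ε) (hC : 0 ≤ C)
    (hmm : mm.HasCostBound ε C γ) (hK : 12 ≤ K)
    (hKC : 2 * (16 * (C + 1) + 1) ≤ K * (1 - (2 / 3 : ℝ) ^ (γ - 2))) {n m : ℕ} (hmn : m ≤ n)
    {A : Matrix (Fin n) (Fin m) ℝ} {R : Matrix (Fin m) (Fin m) ℝ} {W : Matrix (Fin n) (Fin m) ℝ}
    {Y : Matrix (Fin m) (Fin n) ℝ} {t : ℕ} (h : (qrr mm n m hmn A).Exec ε (R, W, Y) t) :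
    (t : ℝ) ≤ K * n * (m : ℝ) ^ (γ - 1) := by
  induction m using Nat.strong_induction_on generalizing n t with
  | _ m ih =>
  obtain rfl | rfl | hm2 : m = 0 ∨ m = 1 ∨ 2 ≤ m := by omega
  · rw [exec_qrr_zero h, Nat.cast_zero]
    positivity
  · obtain ⟨ρ, w, y, hhouse, -⟩ := exec_qrr_one h
    have ht : (t : ℝ) ≤ 12 * n := by exact_mod_cast exec_householder_cost hε hhouse
    rw [Nat.cast_one, Real.one_rpow, mul_one]
    exact ht.trans (by gcongr)
  · obtain ⟨l, hl⟩ : ∃ l, l = m / 2 := ⟨_, rfl⟩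
    have hlm : l < m := by omega
    obtain ⟨RL, WL, YL, AR, RR, WR, YR, XB, tL, tAR, tR, tX, hL, hAR, hR, hXB, -, -, -, rfl⟩ :=
      exec_qrr_of_two_le hm2 hl hlm.le hmn h
    have hL := ih l hlm _ hL
    have hR := ih (m - l) (by omega) _ hR
    have hAR := exec_wyApply_cost hγ hC hmm (by omega) hlm.le (Nat.sub_le m l) hAR
    have hXB := exec_wyApply_cost hγ hC hmm (by omega) (Nat.sub_le m l) hlm.le hXB
    have hlr : (l : ℝ) + (m - l : ℕ) = m := by exact_mod_cast Nat.add_sub_cancel' hlm.le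
    have hl3 : 3 * (l : ℝ) ≤ 2 * m := by exact_mod_cast (by omega : 3 * l ≤ 2 * m)
    have hr3 : 3 * ((m - l : ℕ) : ℝ) ≤ 2 * m := by
      exact_mod_cast (by omega : 3 * (m - l) ≤ 2 * m)
    have hpow := rpow_add_rpow_le (g := γ - 1) (θ := 2 / 3) (by linarith) (Nat.cast_nonneg l)
      (Nat.cast_nonneg (m - l)) hlr (by linarith) (by linarith) (by norm_num)
    rw [show γ - 1 - 1 = γ - 2 by ring] at hpow
    have : 0 ≤ K := by linarith
    have hnl : ((n - l : ℕ) : ℝ) ≤ n := by exact_mod_cast Nat.sub_le n l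
    push_cast
    calc (tL + tAR + tR + tX : ℝ)
        ≤ K * n * l ^ (γ - 1) + (16 * (C + 1) + 1) * (n * m ^ (γ - 1)) +
          K * n * (m - l : ℕ) ^ (γ - 1) + (16 * (C + 1) + 1) * (n * m ^ (γ - 1)) := by
          gcongr ?_ + ?_ + ?_ + ?_
          exacts [hR.trans (by gcongr), hXB.trans (by gcongr)]
      _ = K * n * (l ^ (γ - 1) + (m - l : ℕ) ^ (γ - 1)) +
          2 * (16 * (C + 1) + 1) * (n * m ^ (γ - 1)) := by ring
      _ ≤ K * n * ((2 / 3) ^ (γ - 2) * m ^ (γ - 1)) +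
          K * (1 - (2 / 3) ^ (γ - 2)) * (n * m ^ (γ - 1)) := by gcongr
      _ = K * n * m ^ (γ - 1) := by ring

theorem MatMul.HasCost.exists_exec_qrr_cost (hγ : 2 < γ) (hmm : mm.HasCost γ) :
    ∃ K : ℝ, ∀ (n m : ℕ) (h : m ≤ n) (ε : ℝ), 0 ≤ ε → ε < 1 →
      ∀ (A : Matrix (Fin n) (Fin m) ℝ) (R : Matrix (Fin m) (Fin m) ℝ)
        (W : Matrix (Fin n) (Fin m) ℝ) (Y : Matrix (Fin m) (Fin n) ℝ) (t : ℕ),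
        (qrr mm n m h A).Exec ε (R, W, Y) t → (t : ℝ) ≤ K * n * (m : ℝ) ^ (γ - 1) := by
  obtain ⟨C, hC⟩ := hmm
  have hθ : 0 < 1 - (2 / 3 : ℝ) ^ (γ - 2) :=
    sub_pos.2 (Real.rpow_lt_one (by norm_num) (by norm_num) (by linarith))
  have hK : 0 ≤ 2 * (16 * (|C| + 1) + 1) / (1 - (2 / 3 : ℝ) ^ (γ - 2)) := by positivity
  refine ⟨12 + 2 * (16 * (|C| + 1) + 1) / (1 - (2 / 3) ^ (γ - 2)),
    fun n m h ε hε hε1 A R W Y t hqrr => ?_⟩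
  have hmm : mm.HasCostBound ε |C| γ := fun k hk A B P t hP =>
    (hC k hk ε hε hε1 A B P t hP).trans (by gcongr; exact le_abs_self C)
  refine exec_qrr_cost hγ hε (abs_nonneg C) hmm (by linarith) ?_ h hqrr
  rw [add_mul, div_mul_cancel₀ _ hθ.ne']
  linarith

end Cost

theorem mainTheorem2 (mm : MatMul) :
    (∀ γ : ℝ, 2 < γ → mm.HasCost γ →
      ∃ C : ℝ, ∀ (n m : ℕ) (h : m ≤ n) (ε : ℝ), 0 ≤ ε → ε < 1 →
        ∀ (A : Matrix (Fin n) (Fin m) ℝ) (R : Matrix (Fin m) (Fin m) ℝ)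
          (W : Matrix (Fin n) (Fin m) ℝ) (Y : Matrix (Fin m) (Fin n) ℝ) (t : ℕ),
          (qrr mm n m h A).Exec ε (R, W, Y) t →
            (t : ℝ) ≤ C * n * (m : ℝ) ^ (γ - 1)) ∧
    (mm.IsStable →
      ∃ (K : ℝ) (c : ℕ), ∀ (n m : ℕ) (h : m ≤ n), ∃ ε₀ : ℝ, 0 < ε₀ ∧
        ∀ ε : ℝ, 0 < ε → ε ≤ ε₀ →
        ∀ (A : Matrix (Fin n) (Fin m) ℝ) (R : Matrix (Fin m) (Fin m) ℝ)
          (W : Matrix (Fin n) (Fin m) ℝ) (Y : Matrix (Fin m) (Fin n) ℝ) (t : ℕ),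
          (qrr mm n m h A).Exec ε (R, W, Y) t →
            (∀ i j, j < i → R i j = 0) ∧
            ∃ (δQT : Matrix (Fin n) (Fin n) ℝ) (δA : Matrix (Fin n) (Fin m) ℝ),
              1 - W * Y + δQT ∈ Matrix.orthogonalGroup (Fin n) ℝ ∧
              (1 - W * Y + δQT) * (A + δA) = vcat R 0 ∧
              ‖δQT‖ ≤ K * (n : ℝ) ^ c * ε ∧
              ‖δA‖ ≤ K * (n : ℝ) ^ c * ε * ‖A‖) := by
  refine ⟨fun γ hγ hmm => hmm.exists_exec_qrr_cost hγ, fun hmm => ?_⟩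
  obtain ⟨K, c, hperturb⟩ := hmm.eventually_exists_perturbation
  refine ⟨K, c, fun n m h => ?_⟩
  obtain ⟨ε₀, hε₀, hsub⟩ := mem_nhdsGT_iff_exists_Ioc_subset.1 (hperturb n m h)
  refine ⟨ε₀, hε₀, fun ε hε hεε₀ A R W Y t hqrr => ?_⟩
  obtain ⟨hR, hδ⟩ := hsub ⟨hε, hεε₀⟩ A R W Y t hqrr
  exact ⟨fun i j hij => hR hij, hδ⟩
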